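/- Let $\lambda$ be the countable power of the uniform measure on $\{0,1\}$, a probability measure on $2^{\mathbb N}$, and let $L^0(\lambda,\mathbb T)$ be the group of $\lambda$-measurable functions $2^{\mathbb N}\to\mathbb T=\{z\in\mathbb C:|z|=1\}$ modulo equality $\lambda$-almost everywhere, with pointwise multiplication and the topology of convergence in measure. Let $\Sigma$ be the set of finite binary sequences, $$X_\infty=\Big\{f\in\mathbb C^{\Sigma}:\ f(s)=\tfrac{f(s0)+f(s1)}{\sqrt2}\ \text{ for all } s\in\Sigma\Big\},$$ and let $\gamma_\infty$ be the unique measure on $X_\infty$ whose image under $f\mapsto f\restriction 2^k$ is, for each $k\ge 0$, the product on $\mathbb C^{2^k}$ of copies of the Gaussian measure with density $\frac1\pi e^{-x^2-y^2}$. Let $\mathrm{Aut}(\gamma_\infty)$ be the group of invertible measure preserving transformations of $(X_\infty,\gamma_\infty)$ modulo equality almost everywhere, with the weak topology. For $n\ge0$, a step function $g\in L^0(\lambda,\mathbb T)$ of level $n$ (one that is constant, with value denoted $g_s$, on each cylinder $[s]$, $s\in 2^{m}$, $m\ge n$) acts on $X_\infty$ by $$(g\cdot f)(s)=\begin{cases}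 g_s f(s) & \text{if } |s|\ge n,\\ 2^{-k/2}\sum_{t\in 2^k} g_{st}f(st) & \text{if } |s|=n-k<n.\end{cases}$$ **Theorem.** The action of step functions extends uniquely to a continuous homomorphism $\Theta:L^0(\lambda,\mathbb T)\to\mathrm{Aut}(\gamma_\infty)$. The Koopman representation $g\mapsto\big(f\mapsto f\circ\Theta(g)^{-1}\big)$ of $L^0(\lambda,\mathbb T)$ on $L^2(\gamma_\infty)$, restricted to the orthogonal complement of the constant functions, is unitarily isomorphic to the $\ell^2$-sum, over all integers $p,q\ge0$ with $p+q>0$, of the representations $\rho_{p,q}$. Here $\rho_{p,q}$ acts on the closed subspace of $L^2\big((2^{\mathbb N})^p\times(2^{\mathbb N})^q,\lambda^{p+q}\big)$ of functions invariant under all permutations of the first $p$ coordinates and all permutations of the last $q$ coordinates, by $$\big(\rho_{p,q}(g)f\big)(a,b)=g(a_1)\cdots g(a_p)\,g(b_1)^{-1}\cdots g(b_q)^{-1}\,f(a,b).$$ -/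

import Mathlib

open MeasureTheory ProbabilityTheory
open scoped symmDiff ENNReal

noncomputable section

namespace KoopmanL0

/-! ### The group of measurable circle-valued functions on the Cantor space -/

/-- The space of infinite binary sequences (`false` is the digit 0 and `true` is the digit 1). -/
abbrev Cantor : Type := ℕ → Bool

/-- The countable power of the uniform measure on the two-point set. -/
def lam : Measure Cantor :=
  Measure.infinitePi fun _ : ℕ => (PMF.uniformOfFintype Bool).toMeasure

instance : IsProbabilityMeasure lam := by
  unfold lam; infer_instance

/-- Measurable functions from the Cantor space to the unit circle, modulo equality almost
everywhere. It is a commutative group under pointwise multiplication. -/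
abbrev L0 : Type := Cantor →ₘ[lam] Circle

/-- The topology of convergence in measure. -/
instance : TopologicalSpace L0 where
  IsOpen U := ∀ g ∈ U, ∃ ε : ℝ, 0 < ε ∧
    ∀ h : L0, lam {a | ε ≤ dist (h a) (g a)} < ENNReal.ofReal ε → h ∈ U
  isOpen_univ := fun _ _ => ⟨1, one_pos, fun _ _ => trivial⟩
  isOpen_inter := by
    rintro U V hU hV g ⟨hgU, hgV⟩
    obtain ⟨ε, hε, h1⟩ := hU g hgU
    obtain ⟨δ, hδ, h2⟩ := hV g hgV
    refine ⟨min ε δ, lt_min hε hδ, fun h hh => ⟨h1 h ?_, h2 h ?_⟩⟩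
    · refine lt_of_le_of_lt (measure_mono fun a ha => ?_)
        (hh.trans_le (ENNReal.ofReal_le_ofReal (min_le_left _ _)))
      exact le_trans (min_le_left ε δ) (by simpa using ha)
    · refine lt_of_le_of_lt (measure_mono fun a ha => ?_)
        (hh.trans_le (ENNReal.ofReal_le_ofReal (min_le_right _ _)))
      exact le_trans (min_le_right ε δ) (by simpa using ha)
  isOpen_sUnion := by
    intro s hs g hg
    obtain ⟨U, hU, hgU⟩ := hg
    obtain ⟨ε, hε, h1⟩ := hs U hU g hgU
    exact ⟨ε, hε, fun h hh => ⟨U, hU, h1 h hh⟩⟩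

/-- The element of `L0` that is constant with value `c s` on each cylinder `[s]`, where `s` is a
binary sequence of length `n`. For fixed `n` these elements form the subgroup of step functions
of level `n`. -/
def step {n : ℕ} (c : (Fin n → Bool) → Circle) : L0 :=
  AEEqFun.mk (fun a : Cantor => c fun i => a i)
    ((continuous_of_discreteTopology (f := c)).comp (by fun_prop)).aestronglyMeasurable

/-! ### The Gaussian space -/

/-- The law of a complex number whose real and imaginary parts are independent Gaussian variables
of mean 0 and variance 1/2. -/
def gam : Measure ℂ :=
  ((gaussianReal 0 (1 / 2)).prod (gaussianReal 0 (1 / 2))).map Complex.equivRealProdCLM.symm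

instance : IsGaussian gam := by
  unfold gam; infer_instance

/-- Functions `f` on the finite binary sequences with `f s = (f (s0) + f (s1)) / √2`. -/
def XInf : Type :=
  {f : List Bool → ℂ // ∀ s, f s = (f (s ++ [false]) + f (s ++ [true])) / (Real.sqrt 2 : ℂ)}

instance : CoeFun XInf fun _ => List Bool → ℂ := ⟨Subtype.val⟩

instance : TopologicalSpace XInf := instTopologicalSpaceSubtype

instance : MeasurableSpace XInf := Subtype.instMeasurableSpace

instance : BorelSpace XInf := Subtype.borelSpace _

instance : SecondCountableTopology XInf :=
  Topology.IsEmbedding.subtypeVal.secondCountableTopology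

instance : TopologicalSpace.MetrizableSpace XInf :=
  Topology.IsEmbedding.subtypeVal.metrizableSpace

/-- Restriction of an element of `XInf` to the binary sequences of length `k`. -/
def restrictLevel (k : ℕ) (f : XInf) : (Fin k → Bool) → ℂ := fun t => f (List.ofFn t)

lemma measurable_restrictLevel (k : ℕ) : Measurable (restrictLevel k) :=
  measurable_pi_lambda _ fun t => (measurable_pi_apply (List.ofFn t)).comp measurable_subtype_coe

/-- Value at `s` of the branching function with root value `ω none` and increments `ω (some s)`. -/
def branch (ω : Option (List Bool) → ℂ) (s : List Bool) : ℂ :=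
  (ω none + ∑ i ∈ Finset.range s.length, (Real.sqrt 2 : ℂ) ^ i *
    ((if s.getD i false then 1 else -1) * ω (some (s.take i)))) / (Real.sqrt 2 : ℂ) ^ s.length

lemma sqrt_two_ne : (Real.sqrt 2 : ℂ) ≠ 0 := by simp

lemma sqrt_two_mul : (Real.sqrt 2 : ℂ) * (Real.sqrt 2 : ℂ) = 2 := by
  rw [← Complex.ofReal_mul, Real.mul_self_sqrt (by norm_num)]; simp

lemma branch_append (ω : Option (List Bool) → ℂ) (s : List Bool) (b : Bool) :
    branch ω (s ++ [b]) =
      (branch ω s + (if b then 1 else -1) * ω (some s)) / (Real.sqrt 2 : ℂ) := by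
  have hs := sqrt_two_ne
  have h : ∀ i ∈ Finset.range s.length, (Real.sqrt 2 : ℂ) ^ i *
      ((if (s ++ [b]).getD i false then 1 else -1) * ω (some ((s ++ [b]).take i))) =
      (Real.sqrt 2 : ℂ) ^ i * ((if s.getD i false then 1 else -1) * ω (some (s.take i))) := by
    intro i hi
    have hi : i < s.length := by simpa using hi
    rw [List.take_append_of_le_length hi.le, List.getD_append _ _ _ _ hi]
  unfold branch
  rw [List.length_append, List.length_singleton, Finset.sum_range_succ, Finset.sum_congr rfl h]
  simp only [List.take_left, List.getD_append_right _ _ _ _ le_rfl, Nat.sub_self,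
    List.getD_cons_zero]
  field_simp
  ring

/-- The branching function as an element of `XInf`. -/
def branchX (ω : Option (List Bool) → ℂ) : XInf :=
  ⟨branch ω, fun s => by
    have hs := sqrt_two_ne
    have h2 := sqrt_two_mul
    rw [branch_append, branch_append]
    simp only [Bool.false_eq_true, if_false, if_true]
    field_simp
    rw [pow_two, h2]
    ring⟩

lemma measurable_branch (s : List Bool) : Measurable fun ω => branch ω s := by
  unfold branch
  fun_prop

lemma measurable_branchX : Measurable branchX :=
  Measurable.subtype_mk (measurable_pi_lambda _ measurable_branch)

/-- The measure on `XInf` whose image under restriction to the sequences of length `k` is the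
product of copies of `gam`, for each `k`; see `map_restrictLevel_gamInf` and
`eq_gamInf_of_map_restrictLevel` for this characterization. It is built as the law of the branching
function with independent increments of law `gam`. -/
def gamInf : Measure XInf :=
  (Measure.infinitePi fun _ : Option (List Bool) => gam).map branchX

instance : IsProbabilityMeasure gamInf :=
  Measure.isProbabilityMeasure_map measurable_branchX.aemeasurable

lemma map_rotation_gam :
    (gam.prod gam).map (fun x : ℂ × ℂ =>
      ((x.1 - x.2) / (Real.sqrt 2 : ℂ), (x.1 + x.2) / (Real.sqrt 2 : ℂ))) = gam.prod gam := by
  have h0 : ∫ z, id z ∂gam = 0 := by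
    have h1 : Integrable (fun x : ℝ × ℝ => x)
        ((gaussianReal 0 (1 / 2)).prod (gaussianReal 0 (1 / 2))) :=
      IsGaussian.integrable_id
    have h2 : ∫ x : ℝ × ℝ, x ∂((gaussianReal 0 (1 / 2)).prod (gaussianReal 0 (1 / 2))) = 0 := by
      ext
      · rw [fst_integral h1, integral_fun_fst (f := fun x : ℝ => x)]
        simp [integral_id_gaussianReal]
      · rw [snd_integral h1, integral_fun_snd (f := fun x : ℝ => x)]
        simp [integral_id_gaussianReal]
    unfold gam
    rw [integral_map (by fun_prop) (by fun_prop)]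
    simp only [id]
    rw [ContinuousLinearEquiv.integral_comp_comm, h2, map_zero]
  have h := IsGaussian.map_rotation_eq_self (μ := gam) h0 (-(Real.pi / 4))
  convert h using 2
  funext x
  have h2 : (Real.sqrt 2 : ℂ) / 2 = 1 / (Real.sqrt 2 : ℂ) := by
    rw [div_eq_div_iff (by simp) sqrt_two_ne, sqrt_two_mul, one_mul]
  simp only [ContinuousLinearMap.rotation_apply, Real.cos_neg, Real.sin_neg, Real.cos_pi_div_four,
    Real.sin_pi_div_four, Complex.real_smul, neg_neg]
  push_cast
  rw [Prod.mk.injEq, h2]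
  constructor <;> ring

lemma indepFun_branchX (k : ℕ) :
    IndepFun (restrictLevel k ∘ branchX)
      (fun (ω : Option (List Bool) → ℂ) (t : Fin k → Bool) => ω (some (List.ofFn t)))
      (Measure.infinitePi fun _ : Option (List Bool) => gam) := by
  classical
  let S : Finset (Option (List Bool)) := insert none
    (((Finset.univ : Finset (Fin k → Bool)) ×ˢ Finset.range k).image
      fun x => some ((List.ofFn x.1).take x.2))
  let T : Finset (Option (List Bool)) :=
    (Finset.univ : Finset (Fin k → Bool)).image fun t => some (List.ofFn t)
  have hST : Disjoint S T := by
    rw [Finset.disjoint_left]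
    intro o hoS hoT
    obtain ⟨t, -, rfl⟩ := Finset.mem_image.1 hoT
    rcases Finset.mem_insert.1 hoS with h | h
    · simp at h
    · obtain ⟨x, hx, hxt⟩ := Finset.mem_image.1 h
      have h1 := congrArg List.length (Option.some_injective _ hxt)
      have h2 : x.2 < k := by simpa using hx
      simp at h1
      omega
  have hS0 : none ∈ S := Finset.mem_insert_self _ _
  have hS1 : ∀ (t : Fin k → Bool) (i : ℕ), i < k → some ((List.ofFn t).take i) ∈ S :=
    fun t i hi => Finset.mem_insert_of_mem (Finset.mem_image.2 ⟨(t, i), by simpa using hi, rfl⟩)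
  have hT : ∀ t : Fin k → Bool, some (List.ofFn t) ∈ T :=
    fun t => Finset.mem_image_of_mem _ (Finset.mem_univ t)
  clear_value S T
  have hI := (iIndepFun_infinitePi (P := fun _ : Option (List Bool) => gam)
    (X := fun _ z => z) (fun _ => measurable_id)).indepFun_finset S T hST
    (fun i => measurable_pi_apply i)
  let E : (S → ℂ) → Option (List Bool) → ℂ := fun y o => if h : o ∈ S then y ⟨o, h⟩ else 0
  have hE : Measurable E := by
    refine measurable_pi_lambda _ fun o => ?_
    by_cases h : o ∈ S
    · simp only [E, h, dite_true]
      exact measurable_pi_apply (⟨o, h⟩ : S)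
    · simp only [E, h, dite_false]
      exact measurable_const
  have h := hI.comp (((measurable_restrictLevel k).comp measurable_branchX).comp hE)
    (measurable_pi_lambda (fun (y : T → ℂ) t => y ⟨some (List.ofFn t), hT t⟩)
      fun t => measurable_pi_apply (⟨some (List.ofFn t), hT t⟩ : T))
  have hXe : restrictLevel k ∘ branchX =
      ((restrictLevel k ∘ branchX) ∘ E) ∘ fun ω (i : S) => ω i := by
    funext ω t
    simp only [Function.comp, restrictLevel, branchX, branch, E]
    rw [dif_pos hS0]
    congr 2
    refine Finset.sum_congr rfl fun i hi => ?_
    have hi : i < k := by simpa using hi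
    rw [dif_pos (hS1 t i hi)]
  rw [hXe]
  exact h

/-- The characterization of `gamInf`. -/
theorem map_restrictLevel_gamInf (k : ℕ) :
    gamInf.map (restrictLevel k) = Measure.pi fun _ => gam := by
  unfold gamInf
  rw [Measure.map_map (measurable_restrictLevel k) measurable_branchX]
  induction k with
  | zero =>
    have h := measurePreserving_eval_infinitePi (fun _ : Option (List Bool) => gam) none
    refine (Measure.pi_eq fun s hs => ?_).symm
    rw [Measure.map_apply ((measurable_restrictLevel 0).comp measurable_branchX)
      (MeasurableSet.univ_pi hs), Fintype.prod_unique]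
    refine Eq.trans ?_ (h.measure_preimage (hs _).nullMeasurableSet)
    congr 1
    ext ω
    simp [restrictLevel, branchX, branch, Unique.forall_iff]
  | succ k ih =>
    set P := Measure.infinitePi fun _ : Option (List Bool) => gam with hP
    set X := restrictLevel k ∘ branchX with hX
    have hXm : Measurable X := (measurable_restrictLevel k).comp measurable_branchX
    let Y : (Option (List Bool) → ℂ) → (Fin k → Bool) → ℂ := fun ω t => ω (some (List.ofFn t))
    have hYm : Measurable Y := by fun_prop
    have hYlaw : P.map Y = Measure.pi fun _ => gam := by
      have h := Measure.map_infinitePi_infinitePi_of_inj (P := fun _ : Option (List Bool) => gam)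
        (f := fun t : Fin k → Bool => some (List.ofFn t))
        (fun t t' h => List.ofFn_injective (Option.some_injective _ h))
      exact h.trans (Measure.infinitePi_eq_pi _)
    have hind : IndepFun X Y P := indepFun_branchX k
    have hlaw : P.map (fun ω => (X ω, Y ω)) =
        (Measure.pi fun _ : Fin k → Bool => gam).prod (Measure.pi fun _ => gam) := by
      rw [hind.map_prod_eq_prod_map_map hXm.aemeasurable hYm.aemeasurable, ih, hYlaw]
    refine (Measure.pi_eq fun s hs => ?_).symm
    rw [Measure.map_apply ((measurable_restrictLevel (k + 1)).comp measurable_branchX)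
      (MeasurableSet.univ_pi hs)]
    let R : ℂ × ℂ → ℂ × ℂ := fun x =>
      ((x.1 - x.2) / (Real.sqrt 2 : ℂ), (x.1 + x.2) / (Real.sqrt 2 : ℂ))
    have hRm : Measurable R := by fun_prop
    have hR : MeasurePreserving R (gam.prod gam) (gam.prod gam) := ⟨hRm, map_rotation_gam⟩
    have hpi := (measurePreserving_pi (fun _ : Fin k → Bool => gam.prod gam)
      (fun _ => gam.prod gam) (fun _ => hR)).comp
      (measurePreserving_arrowProdEquivProdArrow ℂ ℂ (Fin k → Bool) (fun _ => gam)
        (fun _ => gam)).symm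
    have htot := hpi.comp (f := fun ω => (X ω, Y ω)) (μa := P) ⟨hXm.prodMk hYm, hlaw⟩
    let B : (Fin k → Bool) → Set (ℂ × ℂ) := fun t =>
      s (Fin.snoc (α := fun _ => Bool) t false) ×ˢ s (Fin.snoc (α := fun _ => Bool) t true)
    have hB : ∀ t, MeasurableSet (B t) := fun t => (hs _).prod (hs _)
    have h1 := htot.measure_preimage (MeasurableSet.univ_pi hB).nullMeasurableSet
    have hprod : ∏ t, gam (s t) = ∏ t, (gam.prod gam) (B t) := by
      rw [← (Fin.snocEquiv fun _ : Fin (k + 1) => Bool).prod_comp, Fintype.prod_prod_type,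
        Fintype.prod_bool, mul_comm, ← Finset.prod_mul_distrib]
      refine Finset.prod_congr rfl fun t _ => ?_
      rw [Measure.prod_prod]
      rfl
    rw [Measure.pi_pi, ← hprod] at h1
    rw [← h1]
    congr 1
    ext ω
    have key : ∀ (t : Fin k → Bool) (b : Bool),
        branch ω (List.ofFn (Fin.snoc (α := fun _ => Bool) t b)) =
          (X ω t + (if b then 1 else -1) * Y ω t) / (Real.sqrt 2 : ℂ) := by
      intro t b
      rw [List.ofFn_succ']
      simp only [Fin.snoc_castSucc, Fin.snoc_last, List.concat_eq_append]
      rw [branch_append]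
      rfl
    have hall : (∀ t : Fin (k + 1) → Bool, branch ω (List.ofFn t) ∈ s t) ↔
        ∀ t : Fin k → Bool, ∀ b : Bool,
          branch ω (List.ofFn (Fin.snoc (α := fun _ => Bool) t b)) ∈
            s (Fin.snoc (α := fun _ => Bool) t b) := by
      constructor
      · exact fun h t b => h _
      · intro h t
        have := h (Fin.init t) (t (Fin.last k))
        rwa [Fin.snoc_init_self] at this
    have hL : ω ∈ (restrictLevel (k + 1) ∘ branchX) ⁻¹' Set.univ.pi s ↔
        ∀ t : Fin (k + 1) → Bool, branch ω (List.ofFn t) ∈ s t := by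
      simp [restrictLevel, branchX]
    rw [hL, hall]
    simp only [key, Bool.forall_bool]
    simp [B, R, MeasurableEquiv.arrowProdEquivProdArrow, Equiv.arrowProdEquivProdArrow,
      sub_eq_add_neg]

/-- Uniqueness in the characterization of `gamInf`. -/
theorem eq_gamInf_of_map_restrictLevel (ν : Measure XInf)
    (h : ∀ k, ν.map (restrictLevel k) = Measure.pi fun _ => gam) : ν = gamInf := by
  have hfin : IsFiniteMeasure ν := by
    refine ⟨?_⟩
    have := congrArg (fun m => m Set.univ) (h 0)
    simp only [Measure.map_apply (measurable_restrictLevel 0) MeasurableSet.univ,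
      Set.preimage_univ, measure_univ] at this
    rw [this]
    exact ENNReal.one_lt_top
  let m : ℕ → MeasurableSpace XInf := fun k => MeasurableSpace.comap (restrictLevel k) inferInstance
  have hmono : Monotone m := by
    refine monotone_nat_of_le_succ fun k => ?_
    let D : ((Fin (k + 1) → Bool) → ℂ) → (Fin k → Bool) → ℂ := fun y t =>
      (y (Fin.snoc (α := fun _ => Bool) t false) +
        y (Fin.snoc (α := fun _ => Bool) t true)) / (Real.sqrt 2 : ℂ)
    have hD : Measurable D := by fun_prop
    have he : restrictLevel k = D ∘ restrictLevel (k + 1) := by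
      funext f t
      simp only [Function.comp, D, restrictLevel, List.ofFn_succ', Fin.snoc_castSucc,
        Fin.snoc_last, List.concat_eq_append]
      exact f.2 _
    change MeasurableSpace.comap (restrictLevel k) _ ≤ _
    rw [he, ← MeasurableSpace.comap_comp]
    exact MeasurableSpace.comap_mono hD.comap_le
  have hgen : (inferInstance : MeasurableSpace XInf) = ⨆ k, m k := by
    refine le_antisymm ?_ (iSup_le fun k => (measurable_restrictLevel k).comap_le)
    have h1 : ∀ s : List Bool, Measurable[⨆ k, m k] fun f : XInf => f s := by
      intro s
      have h2 : Measurable[m s.length] fun f : XInf => f s := by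
        have h3 : (fun f : XInf => f s) =
            (fun y : (Fin s.length → Bool) → ℂ => y s.get) ∘ restrictLevel s.length := by
          funext f
          simp [restrictLevel]
        rw [h3]
        exact (measurable_pi_apply _).comp (comap_measurable _)
      exact h2.mono (le_iSup m _) le_rfl
    have h4 : Measurable[⨆ k, m k] (Subtype.val : XInf → List Bool → ℂ) :=
      @measurable_pi_lambda _ _ _ (⨆ k, m k) _ _ h1
    exact h4.comap_le
  refine ext_of_generate_finite (⋃ k, {s | MeasurableSet[m k] s}) ?_
    (isPiSystem_iUnion_of_monotone _ (fun k => (m k).isPiSystem_measurableSet)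
      fun i j hij s hs => hmono hij s hs) ?_ ?_
  · exact hgen.trans (MeasurableSpace.generateFrom_iUnion_measurableSet m).symm
  · intro s hs
    obtain ⟨k, A, hA, rfl⟩ := Set.mem_iUnion.1 hs
    rw [← Measure.map_apply (measurable_restrictLevel k) hA,
      ← Measure.map_apply (measurable_restrictLevel k) hA, h, map_restrictLevel_gamInf]
  · have := congrArg (fun m => m Set.univ) (h 0)
    simpa [Measure.map_apply (measurable_restrictLevel 0) MeasurableSet.univ] using this

/-! ### Automorphisms of a measure space -/

section Automorphisms

set_option linter.unusedSectionVars false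

variable {X : Type*} [TopologicalSpace X] [TopologicalSpace.MetrizableSpace X]
  [SecondCountableTopology X] [MeasurableSpace X] [BorelSpace X]

/-- Measure preserving maps of `X` to itself, modulo equality almost everywhere. -/
def MPMap (μ : Measure X) : Type _ := {T : X →ₘ[μ] X // MeasurePreserving T μ μ}

instance (μ : Measure X) : CoeFun (MPMap μ) fun _ => X → X := ⟨fun T => T.1⟩

lemma MPMap.ext {μ : Measure X} {S T : MPMap μ} (h : (S : X → X) =ᵐ[μ] T) : S = T :=
  Subtype.ext (AEEqFun.ext h)

/-- The product is composition: `S * T` is `x ↦ S (T x)`. -/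
instance (μ : Measure X) : Mul (MPMap μ) where
  mul S T := ⟨S.1.compMeasurePreserving T T.2,
    (S.2.comp T.2).congr (S.1.compMeasurePreserving T T.2).stronglyMeasurable.measurable
      (AEEqFun.coeFn_compMeasurePreserving S.1 T.2).symm⟩

instance (μ : Measure X) : One (MPMap μ) where
  one := ⟨AEEqFun.mk id measurable_id.aestronglyMeasurable,
    (MeasurePreserving.id μ).congr (AEEqFun.stronglyMeasurable _).measurable
      (AEEqFun.coeFn_mk _ _).symm⟩

lemma MPMap.coe_mul {μ : Measure X} (S T : MPMap μ) :
    ((S * T : MPMap μ) : X → X) =ᵐ[μ] (S : X → X) ∘ T :=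
  AEEqFun.coeFn_compMeasurePreserving S.1 T.2

lemma MPMap.coe_one (μ : Measure X) : ((1 : MPMap μ) : X → X) =ᵐ[μ] id :=
  AEEqFun.coeFn_mk _ _

instance (μ : Measure X) : Monoid (MPMap μ) where
  mul_assoc R S T := by
    refine MPMap.ext ?_
    have h1 := T.2.quasiMeasurePreserving.ae_eq_comp (MPMap.coe_mul R S)
    have h2 := (MPMap.coe_mul S T).fun_comp R
    exact ((MPMap.coe_mul (R * S) T).trans h1).trans
      (h2.symm.trans (MPMap.coe_mul R (S * T)).symm)
  one_mul T := MPMap.ext <| (MPMap.coe_mul 1 T).trans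
    (T.2.quasiMeasurePreserving.ae_eq_comp (MPMap.coe_one μ))
  mul_one T := MPMap.ext <| (MPMap.coe_mul T 1).trans ((MPMap.coe_one μ).fun_comp T)

/-- The group of invertible measure preserving transformations of `X`, modulo equality almost
everywhere. -/
abbrev Aut (μ : Measure X) : Type _ := (MPMap μ)ˣ

/-- The weak topology on the group of measure preserving transformations: the coarsest one for
which `T ↦ μ (T ⁻¹ A ∆ B)` is continuous for all measurable sets `A`, `B`. -/
instance (μ : Measure X) : TopologicalSpace (Aut μ) :=
  ⨅ (A : {A : Set X // MeasurableSet A}) (B : {B : Set X // MeasurableSet B}),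
    TopologicalSpace.induced (fun T : Aut μ => μ (((T : MPMap μ) ⁻¹' A.1) ∆ B.1)) inferInstance

end Automorphisms

/-! ### The boolean action -/

/-- The action on `XInf` of the step function of level `n` with values `c`. For a sequence `s` of
length at least `n`, the value of the step function on the cylinder `[s]` is `c` applied to the
first `n` digits of `s`. -/
def stepActFun {n : ℕ} (c : (Fin n → Bool) → Circle) (f : List Bool → ℂ) (s : List Bool) : ℂ :=
  if n ≤ s.length then ((c fun i : Fin n => s.getD i false : Circle) : ℂ) * f s
  else (∑ t : Fin (n - s.length) → Bool,
    ((c fun i : Fin n => (s ++ List.ofFn t).getD i false : Circle) : ℂ) * f (s ++ List.ofFn t)) /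
      (Real.sqrt 2 : ℂ) ^ (n - s.length)

lemma sum_split (h : List Bool → ℂ) (k : ℕ) (s : List Bool) :
    ∑ t : Fin (k + 1) → Bool, h (s ++ List.ofFn t) =
      ∑ t : Fin k → Bool, h (s ++ [false] ++ List.ofFn t) +
        ∑ t : Fin k → Bool, h (s ++ [true] ++ List.ofFn t) := by
  rw [← (Fin.consEquiv fun _ : Fin (k + 1) => Bool).sum_comp, Fintype.sum_prod_type,
    Fintype.sum_bool, add_comm]
  simp [Fin.consEquiv, List.ofFn_succ]

lemma stepActFun_of_le {n : ℕ} (c : (Fin n → Bool) → Circle) (f : List Bool → ℂ) (s : List Bool)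
    {k : ℕ} (hk : n = s.length + k) :
    stepActFun c f s = (∑ t : Fin k → Bool,
      ((c fun i : Fin n => (s ++ List.ofFn t).getD i false : Circle) : ℂ) * f (s ++ List.ofFn t)) /
        (Real.sqrt 2 : ℂ) ^ k := by
  obtain rfl : k = n - s.length := by omega
  unfold stepActFun
  split_ifs with h
  · have h0 : n - s.length = 0 := by omega
    generalize n - s.length = k at h0
    subst h0
    simp
  · rfl

/-- The action of step functions on `XInf`. -/
def stepAct {n : ℕ} (c : (Fin n → Bool) → Circle) (f : XInf) : XInf :=
  ⟨stepActFun c f, fun s => by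
    have hs := sqrt_two_ne
    by_cases h : n ≤ s.length
    · have h1 : ∀ b, (fun i : Fin n => (s ++ [b]).getD i false) = fun i : Fin n => s.getD i false := by
        intro b
        funext i
        rw [List.getD_append _ _ _ _ (i.2.trans_le h)]
      have h2 : ∀ b : Bool, n ≤ (s ++ [b]).length := fun b => by simp; omega
      simp only [stepActFun, if_pos h, if_pos (h2 _), h1]
      rw [f.2 s]
      ring
    · obtain ⟨k, hk⟩ : ∃ k, n = s.length + (k + 1) := ⟨n - s.length - 1, by omega⟩
      have h2 : ∀ b : Bool, n = (s ++ [b]).length + k := fun b => by simp; omega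
      rw [stepActFun_of_le c f s hk, stepActFun_of_le c f _ (h2 _),
        stepActFun_of_le c f _ (h2 _),
        sum_split (fun u => ((c fun i : Fin n => u.getD i false : Circle) : ℂ) * f u), pow_succ]
      field_simp⟩

/-- A boolean action of `L0` on `(XInf, gamInf)`, i.e. a homomorphism into the group of
automorphisms, is the Gaussian one if it is continuous and extends the action of step functions. -/
def IsGaussianAction (Θ : L0 →* Aut gamInf) : Prop :=
  Continuous Θ ∧
    ∀ (n : ℕ) (c : (Fin n → Bool) → Circle), ⇑(Θ (step c) : MPMap gamInf) =ᵐ[gamInf] stepAct c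

/-! ### Unitary representations -/

section Representations

variable {G : Type*} [Group G]

/-- Representations of `G` by unitary operators on a Hilbert space `H`. -/
abbrev UnitaryRep (G : Type*) [Group G] (H : Type*) [NormedAddCommGroup H]
    [InnerProductSpace ℂ H] : Type _ := G →* (H ≃ₗᵢ[ℂ] H)

/-- A multiplicative family of isometries indexed by a group consists of unitary operators. -/
def UnitaryRep.ofIsometry {H : Type*} [NormedAddCommGroup H] [InnerProductSpace ℂ H]
    (ρ : G →* (H →ₗᵢ[ℂ] H)) : UnitaryRep G H where
  toFun g :=
    { toFun := ρ g
      invFun := ρ g⁻¹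
      map_add' := (ρ g).map_add
      map_smul' := (ρ g).map_smul
      norm_map' := (ρ g).norm_map
      left_inv := fun v => by
        change (ρ g⁻¹ * ρ g) v = v
        rw [← map_mul, inv_mul_cancel, map_one]; rfl
      right_inv := fun v => by
        change (ρ g * ρ g⁻¹) v = v
        rw [← map_mul, mul_inv_cancel, map_one]; rfl }
  map_one' := by
    ext v
    change ρ 1 v = v
    rw [map_one]; rfl
  map_mul' g h := by
    ext v
    change ρ (g * h) v = ρ g (ρ h v)
    rw [map_mul]; rfl

/-- Restriction of a unitary representation to an invariant subspace. -/
def UnitaryRep.restrict {H : Type*} [NormedAddCommGroup H] [InnerProductSpace ℂ H]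
    (ρ : UnitaryRep G H) (V : Submodule ℂ H) (hV : ∀ g, ∀ v ∈ V, ρ g v ∈ V) :
    UnitaryRep G V :=
  UnitaryRep.ofIsometry
    { toFun := fun g =>
        { toLinearMap := (ρ g).toLinearEquiv.toLinearMap.restrict (hV g)
          norm_map' := fun v => (ρ g).norm_map v }
      map_one' := by
        ext v
        change ρ 1 (v : H) = v
        rw [map_one]; rfl
      map_mul' := fun g h => by
        ext v
        change ρ (g * h) (v : H) = ρ g (ρ h v)
        rw [map_mul]; rfl }

/-- The `ℓ²`-sum of unitary representations, acting coordinatewise. -/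
def UnitaryRep.ellTwoSum {ι : Type*} {H : ι → Type*} [∀ i, NormedAddCommGroup (H i)]
    [∀ i, InnerProductSpace ℂ (H i)] (ρ : ∀ i, UnitaryRep G (H i)) :
    UnitaryRep G (lp H 2) :=
  UnitaryRep.ofIsometry
    { toFun := fun g =>
        { toFun := fun v => ⟨fun i => ρ i g (v i), by
            have h : Memℓp (fun i => ρ i g (v i)) 2 := by
              have h := lp.memℓp v
              rw [memℓp_gen_iff (by norm_num)] at h ⊢
              simpa using h
            exact h⟩
          map_add' := fun v w => by ext i; exact (ρ i g).map_add (v i) (w i)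
          map_smul' := fun c v => by ext i; exact (ρ i g).map_smul c (v i)
          norm_map' := fun v => by
            rw [lp.norm_eq_tsum_rpow (by norm_num), lp.norm_eq_tsum_rpow (by norm_num)]
            simp }
      map_one' := by ext v i; simp
      map_mul' := fun g h => by ext v i; simp }

/-- Two unitary representations are isomorphic if there is an equivariant isomorphism of Hilbert
spaces between them. -/
def UnitaryRep.Isomorphic {H K : Type*} [NormedAddCommGroup H] [InnerProductSpace ℂ H]
    [NormedAddCommGroup K] [InnerProductSpace ℂ K] (ρ : UnitaryRep G H) (ρ' : UnitaryRep G K) :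
    Prop :=
  ∃ Φ : H ≃ₗᵢ[ℂ] K, ∀ (g : G) (v : H), Φ (ρ g v) = ρ' g (Φ v)

end Representations

/-! ### The Koopman representation -/

section Koopman

variable {X : Type*} [TopologicalSpace X] [TopologicalSpace.MetrizableSpace X]
  [SecondCountableTopology X] [MeasurableSpace X] [BorelSpace X]

/-- The Koopman representation: the automorphism `T` acts on `L²` by `f ↦ f ∘ T⁻¹`. -/
def koopman (μ : Measure X) : UnitaryRep (Aut μ) (Lp ℂ 2 μ) :=
  UnitaryRep.ofIsometry
    { toFun := fun T => Lp.compMeasurePreservingₗᵢ ℂ ((T⁻¹ : Aut μ) : MPMap μ)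
        ((T⁻¹ : Aut μ) : MPMap μ).2
      map_one' := by
        ext1 f
        refine Lp.ext ((Lp.coeFn_compMeasurePreserving f _).trans ?_)
        have h : ((((1 : Aut μ)⁻¹ : Aut μ) : MPMap μ) : X → X) =ᵐ[μ] id := by
          rw [inv_one]
          exact MPMap.coe_one μ
        exact h.fun_comp f
      map_mul' := fun S T => by
        ext1 f
        refine Lp.ext ((Lp.coeFn_compMeasurePreserving f _).trans ?_)
        have h : ((((S * T)⁻¹ : Aut μ) : MPMap μ) : X → X) =ᵐ[μ]
            (((T⁻¹ : Aut μ) : MPMap μ) : X → X) ∘ ((S⁻¹ : Aut μ) : MPMap μ) := by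
          rw [mul_inv_rev, Units.val_mul]
          exact MPMap.coe_mul _ _
        refine (h.fun_comp f).trans ?_
        have hT := Lp.coeFn_compMeasurePreserving f ((T⁻¹ : Aut μ) : MPMap μ).2
        have hS := Lp.coeFn_compMeasurePreserving
          (Lp.compMeasurePreserving _ ((T⁻¹ : Aut μ) : MPMap μ).2 f) ((S⁻¹ : Aut μ) : MPMap μ).2
        have hTS := ((S⁻¹ : Aut μ) : MPMap μ).2.quasiMeasurePreserving.ae_eq_comp hT
        exact (hS.trans hTS).symm }

/-- The subspace of constant functions in `L²`. -/
def constants (μ : Measure X) [IsFiniteMeasure μ] : Submodule ℂ (Lp ℂ 2 μ) :=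
  LinearMap.range (Lp.constₗ 2 μ ℂ : ℂ →ₗ[ℂ] Lp ℂ 2 μ)

lemma koopman_const (μ : Measure X) [IsFiniteMeasure μ] (T : Aut μ) (c : ℂ) :
    koopman μ T (Lp.const 2 μ c) = Lp.const 2 μ c := by
  refine Lp.ext ((Lp.coeFn_compMeasurePreserving (Lp.const 2 μ c) _).trans ?_)
  have h := Lp.coeFn_const (p := 2) (μ := μ) c
  exact (((T⁻¹ : Aut μ) : MPMap μ).2.quasiMeasurePreserving.ae_eq_comp h).trans h.symm

lemma koopman_mem_orthogonal (μ : Measure X) [IsFiniteMeasure μ] (T : Aut μ) (f : Lp ℂ 2 μ)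
    (hf : f ∈ (constants μ)ᗮ) : koopman μ T f ∈ (constants μ)ᗮ := by
  rw [Submodule.mem_orthogonal] at hf ⊢
  rintro _ ⟨c, rfl⟩
  have h := hf _ ⟨c, rfl⟩
  rw [← (koopman μ T).inner_map_map] at h
  simpa [koopman_const] using h

/-- The Koopman representation of a boolean action, restricted to the orthogonal complement of the
constant functions. -/
def koopmanZero {G : Type*} [Group G] {μ : Measure X} [IsFiniteMeasure μ] (Θ : G →* Aut μ) :
    UnitaryRep G ((constants μ)ᗮ : Submodule ℂ (Lp ℂ 2 μ)) :=
  UnitaryRep.restrict ((koopman μ).comp Θ) (constants μ)ᗮ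
    fun g f hf => koopman_mem_orthogonal μ (Θ g) f hf

end Koopman

/-! ### The multiplication representations -/

section Multiplication

variable {Y : Type*} [MeasurableSpace Y] {μ : Measure Y}

lemma memLp_circle_mul (u : Y →ₘ[μ] Circle) (f : Lp ℂ 2 μ) :
    MemLp (fun y => (u y : ℂ) * f y) 2 μ :=
  (Lp.memLp f).of_le
    (((continuous_subtype_val : Continuous ((↑) : Circle → ℂ)).comp_aestronglyMeasurable u.aestronglyMeasurable).mul
      (Lp.aestronglyMeasurable f))
    (ae_of_all _ fun y => by rw [norm_mul, Circle.norm_coe, one_mul])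

/-- Multiplication of `L²` functions by a unimodular function. -/
def circleMul (u : Y →ₘ[μ] Circle) : Lp ℂ 2 μ →ₗᵢ[ℂ] Lp ℂ 2 μ where
  toFun f := (memLp_circle_mul u f).toLp _
  map_add' f g := by
    refine Lp.ext ?_
    filter_upwards [(memLp_circle_mul u (f + g)).coeFn_toLp, (memLp_circle_mul u f).coeFn_toLp,
      (memLp_circle_mul u g).coeFn_toLp, Lp.coeFn_add f g,
      Lp.coeFn_add ((memLp_circle_mul u f).toLp _) ((memLp_circle_mul u g).toLp _)]
      with y h1 h2 h3 h4 h5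
    rw [h1, h5, Pi.add_apply, h2, h3, h4, Pi.add_apply, mul_add]
  map_smul' c f := by
    refine Lp.ext ?_
    filter_upwards [(memLp_circle_mul u (c • f)).coeFn_toLp, (memLp_circle_mul u f).coeFn_toLp,
      Lp.coeFn_smul c f, Lp.coeFn_smul c ((memLp_circle_mul u f).toLp _)] with y h1 h2 h3 h4
    rw [h1, RingHom.id_apply, h4, Pi.smul_apply, h2, h3, Pi.smul_apply, smul_eq_mul, smul_eq_mul,
      mul_left_comm]
  norm_map' f := by
    change ‖(memLp_circle_mul u f).toLp _‖ = ‖f‖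
    rw [Lp.norm_toLp, Lp.norm_def]
    congr 1
    exact eLpNorm_congr_norm_ae (ae_of_all _ fun y => by rw [norm_mul, Circle.norm_coe, one_mul])

lemma coeFn_circleMul (u : Y →ₘ[μ] Circle) (f : Lp ℂ 2 μ) :
    circleMul u f =ᵐ[μ] fun y => (u y : ℂ) * f y :=
  (memLp_circle_mul u f).coeFn_toLp

/-- The action of unimodular functions on `L²` by multiplication. -/
def mulRep (μ : Measure Y) : UnitaryRep (Y →ₘ[μ] Circle) (Lp ℂ 2 μ) :=
  UnitaryRep.ofIsometry
    { toFun := circleMul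
      map_one' := by
        ext1 f
        refine Lp.ext ?_
        filter_upwards [coeFn_circleMul (1 : Y →ₘ[μ] Circle) f,
          AEEqFun.coeFn_one (α := Y) (μ := μ) (β := Circle)] with y h1 h2
        rw [h1, h2]
        simp
      map_mul' := fun u v => by
        ext1 f
        refine Lp.ext ?_
        filter_upwards [coeFn_circleMul (u * v) f, coeFn_circleMul u (circleMul v f),
          coeFn_circleMul v f, AEEqFun.coeFn_mul u v] with y h1 h2 h3 h4
        rw [h1, h4]
        change _ = circleMul u (circleMul v f) y
        rw [h2, h3, Pi.mul_apply, Circle.coe_mul, mul_assoc] }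

end Multiplication

/-- The space of pairs `(a, b)` of a sequence of `p` and a sequence of `q` points. -/
abbrev CSpace (p q : ℕ) : Type := (Fin p → Cantor) × (Fin q → Cantor)

/-- The product of `p + q` copies of `lam`. -/
def muPQ (p q : ℕ) : Measure (CSpace p q) :=
  (Measure.pi fun _ => lam).prod (Measure.pi fun _ => lam)

instance (p q : ℕ) : IsProbabilityMeasure (muPQ p q) := by
  unfold muPQ; infer_instance

lemma mp_fst (p q : ℕ) (i : Fin p) :
    MeasurePreserving (fun x : CSpace p q => x.1 i) (muPQ p q) lam :=
  (measurePreserving_eval (fun _ => lam) i).comp measurePreserving_fst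

lemma mp_snd (p q : ℕ) (j : Fin q) :
    MeasurePreserving (fun x : CSpace p q => x.2 j) (muPQ p q) lam :=
  (measurePreserving_eval (fun _ => lam) j).comp measurePreserving_snd

lemma mp_comp_perm (n : ℕ) (σ : Equiv.Perm (Fin n)) :
    MeasurePreserving (fun a : Fin n → Cantor => a ∘ σ) (Measure.pi fun _ => lam)
      (Measure.pi fun _ => lam) := by
  have h := measurePreserving_piCongrLeft (fun _ : Fin n => lam) σ⁻¹
  convert h using 1
  funext a i
  simp [MeasurableEquiv.piCongrLeft, Equiv.piCongrLeft_apply]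
  rfl

lemma mp_perm (p q : ℕ) (σ : Equiv.Perm (Fin p)) (τ : Equiv.Perm (Fin q)) :
    MeasurePreserving (fun x : CSpace p q => (x.1 ∘ σ, x.2 ∘ τ)) (muPQ p q) (muPQ p q) :=
  (mp_comp_perm p σ).prod (mp_comp_perm q τ)

/-- The function `g(a₁) ⋯ g(a_p) g(b₁)⁻¹ ⋯ g(b_q)⁻¹`. -/
def rFun (p q : ℕ) (g : Cantor → Circle) (x : CSpace p q) : Circle :=
  (∏ i, g (x.1 i)) * ∏ j, (g (x.2 j))⁻¹

lemma aestronglyMeasurable_rFun (p q : ℕ) (g : L0) :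
    AEStronglyMeasurable (rFun p q g) (muPQ p q) := by
  unfold rFun
  refine AEStronglyMeasurable.mul ?_ ?_
  · exact Finset.aestronglyMeasurable_fun_prod _ fun i _ =>
      g.aestronglyMeasurable.comp_measurePreserving (mp_fst p q i)
  · exact Finset.aestronglyMeasurable_fun_prod _ fun j _ =>
      (g.aestronglyMeasurable.comp_measurePreserving (mp_snd p q j)).inv

lemma rFun_congr (p q : ℕ) {g h : Cantor → Circle} (hgh : g =ᵐ[lam] h) :
    rFun p q g =ᵐ[muPQ p q] rFun p q h := by
  have h1 : ∀ᵐ x ∂muPQ p q, ∀ i, g (x.1 i) = h (x.1 i) :=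
    ae_all_iff.2 fun i => (mp_fst p q i).quasiMeasurePreserving.ae_eq_comp hgh
  have h2 : ∀ᵐ x ∂muPQ p q, ∀ j, g (x.2 j) = h (x.2 j) :=
    ae_all_iff.2 fun j => (mp_snd p q j).quasiMeasurePreserving.ae_eq_comp hgh
  filter_upwards [h1, h2] with x hx1 hx2
  simp [rFun, hx1, hx2]

/-- The class of `g(a₁) ⋯ g(a_p) g(b₁)⁻¹ ⋯ g(b_q)⁻¹`, as a homomorphism in `g`. -/
def rMap (p q : ℕ) : L0 →* (CSpace p q →ₘ[muPQ p q] Circle) where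
  toFun g := AEEqFun.mk (rFun p q g) (aestronglyMeasurable_rFun p q g)
  map_one' := by
    refine AEEqFun.ext ((AEEqFun.coeFn_mk _ _).trans ?_)
    filter_upwards [rFun_congr p q (AEEqFun.coeFn_one (α := Cantor) (μ := lam) (β := Circle)),
      AEEqFun.coeFn_one (α := CSpace p q) (μ := muPQ p q) (β := Circle)] with x h1 h2
    rw [h1, h2]
    simp [rFun]
  map_mul' g h := by
    refine AEEqFun.ext ((AEEqFun.coeFn_mk _ _).trans ?_)
    filter_upwards [rFun_congr p q (AEEqFun.coeFn_mul g h),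
      AEEqFun.coeFn_mul (AEEqFun.mk (rFun p q g) (aestronglyMeasurable_rFun p q g))
        (AEEqFun.mk (rFun p q h) (aestronglyMeasurable_rFun p q h)),
      AEEqFun.coeFn_mk (rFun p q g) (aestronglyMeasurable_rFun p q g),
      AEEqFun.coeFn_mk (rFun p q h) (aestronglyMeasurable_rFun p q h)] with x h1 h2 h3 h4
    rw [h1, h2, Pi.mul_apply, h3, h4]
    simp only [rFun, Pi.mul_apply, mul_inv, Finset.prod_mul_distrib]
    exact mul_mul_mul_comm _ _ _ _

/-- The subspace of `L²` of functions invariant under permutations of the first `p` and of the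
last `q` coordinates. -/
def symL2 (p q : ℕ) : Submodule ℂ (Lp ℂ 2 (muPQ p q)) where
  carrier := {f | ∀ σ τ, Lp.compMeasurePreserving _ (mp_perm p q σ τ) f = f}
  zero_mem' := fun σ τ => map_zero _
  add_mem' := fun hf hg σ τ => by rw [map_add, hf σ τ, hg σ τ]
  smul_mem' := fun c f hf σ τ =>
    ((Lp.compMeasurePreservingₗ ℂ _ (mp_perm p q σ τ)).map_smul c f).trans
      (congrArg (c • ·) (hf σ τ))

lemma mulRep_mem_symL2 (p q : ℕ) (g : L0) (f : Lp ℂ 2 (muPQ p q)) (hf : f ∈ symL2 p q) :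
    mulRep (muPQ p q) (rMap p q g) f ∈ symL2 p q := by
  intro σ τ
  have hm := coeFn_circleMul (rMap p q g) f
  have hr : rMap p q g =ᵐ[muPQ p q] rFun p q g := AEEqFun.coeFn_mk _ _
  have hf' := Lp.coeFn_compMeasurePreserving f (mp_perm p q σ τ)
  rw [hf σ τ] at hf'
  have hq := (mp_perm p q σ τ).quasiMeasurePreserving
  change Lp.compMeasurePreserving _ (mp_perm p q σ τ) (circleMul (rMap p q g) f) =
    circleMul (rMap p q g) f
  refine Lp.ext ?_
  filter_upwards [Lp.coeFn_compMeasurePreserving (circleMul (rMap p q g) f) (mp_perm p q σ τ),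
    hm, hq.ae_eq_comp hm, hr, hq.ae_eq_comp hr, hf'] with x h1 h2 h3 h4 h5 h6
  rw [h1, h3, h2, h6, h4]
  simp only [Function.comp] at h5 ⊢
  rw [h5]
  congr 2
  simp only [rFun, Function.comp]
  rw [Equiv.prod_comp σ fun i => g (x.1 i), Equiv.prod_comp τ fun j => (g (x.2 j))⁻¹]

/-- The representation of `L0` on symmetric functions by multiplication with
`g(a₁) ⋯ g(a_p) g(b₁)⁻¹ ⋯ g(b_q)⁻¹`. -/
def rho (p q : ℕ) : UnitaryRep L0 (symL2 p q) :=
  UnitaryRep.restrict ((mulRep (muPQ p q)).comp (rMap p q)) (symL2 p q)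
    fun g f hf => mulRep_mem_symL2 p q g f hf

end KoopmanL0

end

section

open Filter Topology
open scoped InnerProductSpace

noncomputable section

namespace KoopmanL0

/-! ### Isometries determined by Gram matrices -/

section Gram

variable {ι H K : Type*} [NormedAddCommGroup H] [InnerProductSpace ℂ H] [NormedAddCommGroup K]
  [InnerProductSpace ℂ K]

/-! The linear functionals on `XInf` form a Gaussian copy of `L²(λ)`. The step function `c` of level
`n` corresponds to `phi c f = 2^{-n/2} ∑ c_t f(t)`, and since the coordinates of one level are
orthonormal, this extends to an isometry `W : L²(λ) → L²(γ∞)`. The characteristic function of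
`gamInf` at `c` is `exp(-‖c‖²/4)`, so it sees only the norm. Multiplication by `g` is unitary on
`L²(λ)`. Hence replacing each coordinate functional by its image under `g` gives a point map with
the same characteristic function, that is, a measure preserving one (`measurePreserving_actFun`). It
satisfies `W h ∘ actMap g = W (g h)` (`comp_actMap`), which makes `actMap` multiplicative and yields
the prescribed formula on step functions.

Continuity is tested on the total family of characters `cis (phi c)`, where it reduces to dominated
convergence in `L²(λ)`; the weak topology is read off from `L²` distances between indicators.
Uniqueness holds because every `g` is an almost everywhere limit of unimodular step functions and
limits in `Aut` are unique.

For the spectral statement, take the exponential vectors `E(h,k) = exp(-⟪k,h⟫) exp(φ_h + conj φ_k)`.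
Their Gram matrix is `exp(⟪h,h'⟫ + ⟪k',k⟫)`, and its expansion `∑ ⟪k',k⟫^p ⟪h,h'⟫^q / (p! q!)` is
the Gram matrix of the vectors with components `k̄^{⊗p} ⊗ h^{⊗q} / √(p! q!)` in the sum of the
symmetric spaces. Subtracting 1 removes the constants on one side and degree `(0,0)` on the other.
Both families are total (`expVec_total`, `fockVec_total`), so matching them defines a unitary
operator (`exists_expVec_equiv`). A step function `g` sends the vector of `(h,k)` to the vector of
`(g⁻¹h, g⁻¹k)` on both sides, so the operator intertwines the step functions, and by a limit
argument all of `L0`. -/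

lemma inner_linearCombination_eq {e : ι → H} {f : ι → K}
    (hef : ∀ i j, ⟪e i, e j⟫_ℂ = ⟪f i, f j⟫_ℂ) (c d : ι →₀ ℂ) :
    ⟪Finsupp.linearCombination ℂ e c, Finsupp.linearCombination ℂ e d⟫_ℂ =
      ⟪Finsupp.linearCombination ℂ f c, Finsupp.linearCombination ℂ f d⟫_ℂ := by
  simp only [Finsupp.linearCombination_apply, Finsupp.sum, sum_inner, inner_sum, inner_smul_left,
    inner_smul_right, hef]

lemma norm_linearCombination_eq {e : ι → H} {f : ι → K}
    (hef : ∀ i j, ⟪e i, e j⟫_ℂ = ⟪f i, f j⟫_ℂ) (c : ι →₀ ℂ) :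
    ‖Finsupp.linearCombination ℂ f c‖ = ‖Finsupp.linearCombination ℂ e c‖ := by
  rw [@norm_eq_sqrt_re_inner ℂ, @norm_eq_sqrt_re_inner ℂ, inner_linearCombination_eq hef]

/-- Equal Gram matrices give equal norms to corresponding finite combinations, so the assignment is
well defined and isometric on a dense subspace and extends by completeness of `K`. -/
lemma exists_linearIsometry_of_inner_eq [CompleteSpace K] {e : ι → H} {f : ι → K}
    (hef : ∀ i j, ⟪e i, e j⟫_ℂ = ⟪f i, f j⟫_ℂ)
    (he : (Submodule.span ℂ (Set.range e)).topologicalClosure = ⊤) :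
    ∃ U : H →ₗᵢ[ℂ] K, ∀ i, U (e i) = f i := by
  have hd : DenseRange (Finsupp.linearCombination ℂ e) := by
    have h := Submodule.dense_iff_topologicalClosure_eq_top.2 he
    rwa [← Finsupp.range_linearCombination] at h
  have hn : ∀ c, ‖Finsupp.linearCombination ℂ f c‖ ≤ 1 * ‖Finsupp.linearCombination ℂ e c‖ :=
    fun c => by rw [one_mul, norm_linearCombination_eq hef]
  let U := (Finsupp.linearCombination ℂ f).extendOfNorm (Finsupp.linearCombination ℂ e)
  have hU : ∀ c, U (Finsupp.linearCombination ℂ e c) = Finsupp.linearCombination ℂ f c :=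
    LinearMap.extendOfNorm_eq hd ⟨1, hn⟩
  refine ⟨⟨U.toLinearMap, fun x => ?_⟩, fun i => ?_⟩
  · refine hd.induction_on (p := fun x => ‖U x‖ = ‖x‖) x
      (isClosed_eq (by fun_prop) (by fun_prop)) fun c => ?_
    rw [hU, norm_linearCombination_eq hef]
  · have h := hU (Finsupp.single i 1)
    rwa [Finsupp.linearCombination_single, Finsupp.linearCombination_single, one_smul,
      one_smul] at h

/-- The range of the isometry is closed, being complete, and contains the total family `f`. -/
lemma exists_linearIsometryEquiv_of_inner_eq [CompleteSpace H] [CompleteSpace K] {e : ι → H}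
    {f : ι → K} (hef : ∀ i j, ⟪e i, e j⟫_ℂ = ⟪f i, f j⟫_ℂ)
    (he : (Submodule.span ℂ (Set.range e)).topologicalClosure = ⊤)
    (hf : (Submodule.span ℂ (Set.range f)).topologicalClosure = ⊤) :
    ∃ U : H ≃ₗᵢ[ℂ] K, ∀ i, U (e i) = f i := by
  obtain ⟨U, hU⟩ := exists_linearIsometry_of_inner_eq hef he
  refine ⟨LinearIsometryEquiv.ofSurjective U ?_, hU⟩
  have h1 : IsClosed (Set.range U) := U.isometry.isClosedEmbedding.isClosed_range
  have h2 : (Submodule.span ℂ (Set.range f)).topologicalClosure ≤ LinearMap.range U.toLinearMap := by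
    refine Submodule.topologicalClosure_minimal _ ?_ h1
    rw [Submodule.span_le]
    rintro _ ⟨i, rfl⟩
    exact ⟨e i, hU i⟩
  intro y
  exact h2 (hf ▸ Submodule.mem_top)

lemma span_closure_eq_top [CompleteSpace H] {e : ι → H}
    (h : ∀ v : H, (∀ i, ⟪e i, v⟫_ℂ = 0) → v = 0) :
    (Submodule.span ℂ (Set.range e)).topologicalClosure = ⊤ := by
  rw [Submodule.topologicalClosure_eq_top_iff, Submodule.eq_bot_iff]
  intro v hv
  exact h v fun i => (Submodule.mem_orthogonal _ v).1 hv _ (Submodule.subset_span ⟨i, rfl⟩)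

lemma eq_of_total {E : Type*} [TopologicalSpace E] [T2Space E] [AddCommMonoid E] [Module ℂ E]
    {e : ι → H}
    (he : (Submodule.span ℂ (Set.range e)).topologicalClosure = ⊤) {S T : H →L[ℂ] E}
    (h : ∀ i, S (e i) = T (e i)) : S = T := by
  refine ContinuousLinearMap.ext_on (Submodule.dense_iff_topologicalClosure_eq_top.2 he) ?_
  rintro _ ⟨i, rfl⟩
  exact h i

/-- Strong convergence of isometries may be checked on a total family. -/
lemma tendsto_of_total {e : ι → H}
    (he : (Submodule.span ℂ (Set.range e)).topologicalClosure = ⊤) {S : ℕ → H →ₗᵢ[ℂ] K}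
    {T : H →ₗᵢ[ℂ] K} (h : ∀ i, Tendsto (fun n => S n (e i)) atTop (𝓝 (T (e i)))) (x : H) :
    Tendsto (fun n => S n x) atTop (𝓝 (T x)) := by
  have hx : x ∈ closure (Submodule.span ℂ (Set.range e) : Set H) := by
    have : x ∈ (Submodule.span ℂ (Set.range e)).topologicalClosure := he ▸ Submodule.mem_top
    exact this
  have hspan : ∀ y ∈ Submodule.span ℂ (Set.range e),
      Tendsto (fun n => S n y) atTop (𝓝 (T y)) := by
    intro y hy
    induction hy using Submodule.span_induction with
    | mem y hy => obtain ⟨i, rfl⟩ := hy; exact h i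
    | zero => simp
    | add y z _ _ h1 h2 => simpa using h1.add h2
    | smul c y _ h1 => simpa using h1.const_smul c
  rw [Metric.tendsto_atTop]
  intro ε hε
  obtain ⟨y, hy, hxy⟩ := Metric.mem_closure_iff.1 hx (ε / 3) (by positivity)
  obtain ⟨N, hN⟩ := Metric.tendsto_atTop.1 (hspan y hy) (ε / 3) (by positivity)
  refine ⟨N, fun n hn => ?_⟩
  have h1 := dist_triangle4 (S n x) (S n y) (T y) (T x)
  rw [(S n).dist_map, T.dist_map, dist_comm y x] at h1
  have := hN n hn
  linarith

lemma intertwines_of_total {e : ι → H}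
    (he : (Submodule.span ℂ (Set.range e)).topologicalClosure = ⊤) {A : H ≃ₗᵢ[ℂ] H}
    {B : K ≃ₗᵢ[ℂ] K} {Φ : H ≃ₗᵢ[ℂ] K} (h : ∀ i, Φ (A (e i)) = B (Φ (e i))) (x : H) :
    Φ (A x) = B (Φ x) :=
  congrArg (fun S : H →L[ℂ] K => S x)
    (eq_of_total he (S := (A.trans Φ).toLinearIsometry.toContinuousLinearMap)
      (T := (Φ.trans B).toLinearIsometry.toContinuousLinearMap) h)

end Gram

/-! ### Power series -/

lemma coeff_eq_zero_of_hasSum {a : ℕ → ℂ} (h : ∀ z : ℂ, HasSum (fun n => a n * z ^ n) 0) (n : ℕ) :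
    a n = 0 := by
  have hp : HasFPowerSeriesAt (0 : ℂ → ℂ) (FormalMultilinearSeries.ofScalars ℂ a) 0 := by
    rw [hasFPowerSeriesAt_iff]
    refine Eventually.of_forall fun z => ?_
    simpa [FormalMultilinearSeries.coeff_ofScalars, mul_comm] using h z
  have h0 := hp.eq_zero
  have h1 := FormalMultilinearSeries.coeff_ofScalars (p := a) (n := n) (𝕜 := ℂ)
  rw [h0] at h1
  rw [← h1]
  rfl

/-- Summing over `q` first leaves a power series in `z` for fixed `w`; its coefficients vanish and
are themselves power series in `w`. -/
lemma coeff_eq_zero_of_hasSum_two {a : ℕ × ℕ → ℂ}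
    (h : ∀ z w : ℂ, HasSum (fun i : ℕ × ℕ => a i * z ^ i.1 * w ^ i.2) 0) (i : ℕ × ℕ) :
    a i = 0 := by
  have h1 : ∀ (w : ℂ) (p : ℕ), ∑' q, a (p, q) * w ^ q = 0 := by
    intro w
    refine coeff_eq_zero_of_hasSum fun z => ?_
    have h2 := (h z w).prod_fiberwise fun p => ((h z w).summable.prod_factor p).hasSum
    convert h2 using 2 with p
    rw [← tsum_mul_right]
    exact tsum_congr fun q => by ring
  refine coeff_eq_zero_of_hasSum (a := fun q => a (i.1, q)) (fun w => ?_) i.2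
  have h2 := (h 1 w).summable.prod_factor i.1
  simp only [one_pow, mul_one] at h2
  rw [← h1 w i.1]
  exact h2.hasSum

/-! ### Polarization -/

/-- Polarization: expanding the product gives a sum over all maps `f` of the index set to itself,
and inclusion-exclusion over `S` cancels those that are not surjective. The surjective ones are the
permutations. This recovers a symmetrized tensor from diagonal ones. -/
lemma sum_powerset_prod_sum {n : ℕ} (M : Fin n → Fin n → ℂ) :
    ∑ S : Finset (Fin n), (-1 : ℂ) ^ (n - S.card) * ∏ i, ∑ j ∈ S, M j i =
      ∑ σ : Equiv.Perm (Fin n), ∏ i, M (σ i) i := by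
  classical
  -- The factor 0 at points of the range of `f` outside `S` encodes the condition that `f` maps into
  -- `S`; the remaining factors `-1` make up the sign.
  have hS : ∀ S : Finset (Fin n), (-1 : ℂ) ^ (n - S.card) * ∏ i, ∑ j ∈ S, M j i =
      ∑ f : Fin n → Fin n, (∏ j ∈ Finset.univ \ S, if j ∈ Set.range f then 0 else -1) *
        ∏ i, M (f i) i := by
    intro S
    have h1 : ∏ i, ∑ j ∈ S, M j i = ∑ f : Fin n → Fin n,
        (if ∀ i, f i ∈ S then 1 else 0) * ∏ i, M (f i) i := by
      have : ∀ i, ∑ j ∈ S, M j i = ∑ j, if j ∈ S then M j i else 0 := fun i => by simp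
      simp_rw [this, Fintype.prod_sum]
      refine Finset.sum_congr rfl fun f _ => ?_
      rw [Finset.prod_ite_zero]
      simp
    rw [h1, Finset.mul_sum]
    refine Finset.sum_congr rfl fun f _ => ?_
    rw [← mul_assoc]
    congr 1
    split_ifs with hf
    · rw [mul_one, Finset.prod_congr rfl (g := fun _ => (-1 : ℂ)), Finset.prod_const,
        Finset.card_sdiff_of_subset (Finset.subset_univ S), Finset.card_univ, Fintype.card_fin]
      intro j hj
      refine if_neg ?_
      rintro ⟨i, rfl⟩
      simp [hf i] at hj
    · push Not at hf
      obtain ⟨i, hi⟩ := hf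
      rw [mul_zero, Finset.prod_eq_zero (i := f i) (by simpa using hi) (by simp)]
  simp_rw [hS]
  rw [Finset.sum_comm]
  have hf : ∀ f : Fin n → Fin n, ∑ S : Finset (Fin n),
      (∏ j ∈ Finset.univ \ S, if j ∈ Set.range f then (0 : ℂ) else -1) * ∏ i, M (f i) i =
      if Function.Bijective f then ∏ i, M (f i) i else 0 := by
    intro f
    rw [← Finset.sum_mul]
    -- The sum over `S` factors as a product over `j` of `1 + x_j`, which is 1 if `j` is in the
    -- range of `f` and 0 otherwise.
    have h := Finset.prod_add (fun _ : Fin n => (1 : ℂ))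
      (fun j => if j ∈ Set.range f then (0 : ℂ) else -1) Finset.univ
    simp only [Finset.prod_const_one, one_mul, Finset.powerset_univ] at h
    rw [← h]
    split_ifs with hb
    · rw [Finset.prod_eq_one, one_mul]
      intro j _
      rw [if_pos (Set.mem_range.2 (hb.2 j)), add_zero]
    · rw [← Finite.surjective_iff_bijective, Function.Surjective] at hb
      push Not at hb
      obtain ⟨j, hj⟩ := hb
      rw [Finset.prod_eq_zero (Finset.mem_univ j), zero_mul]
      rw [if_neg (by rintro ⟨i, hi⟩; exact hj i hi), add_neg_cancel]
  simp_rw [hf]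
  refine (Finset.sum_of_injOn (fun σ : Equiv.Perm (Fin n) => (σ : Fin n → Fin n))
    DFunLike.coe_injective.injOn (by simp) (fun f _ hf => ?_) fun σ _ => ?_).symm
  · refine if_neg fun hb => hf ⟨Equiv.ofBijective f hb, by simp, rfl⟩
  · exact (if_pos σ.bijective).symm

/-! ### Functions with vanishing integrals -/

/-- The sets over which `f` has integral 0 form a Dynkin system; the separate hypothesis on the
whole space is what closes it under complements. -/
lemma ae_eq_zero_of_setIntegral_piSystem {α : Type*} [m : MeasurableSpace α] {μ : Measure α}
    {f : α → ℂ} (hf : Integrable f μ) {C : Set (Set α)} (hC : m = MeasurableSpace.generateFrom C)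
    (hpi : IsPiSystem C) (h0 : ∫ x, f x ∂μ = 0) (h : ∀ S ∈ C, ∫ x in S, f x ∂μ = 0) :
    f =ᵐ[μ] 0 := by
  refine hf.ae_eq_zero_of_forall_setIntegral_eq_zero fun S hS _ => ?_
  clear * - hf hC hpi h0 h hS
  induction S, hS using MeasurableSpace.induction_on_inter hC hpi with
  | empty => simp
  | basic t ht => exact h t ht
  | compl t ht iht =>
    have := integral_add_compl ht hf
    rw [iht, h0, zero_add] at this
    exact this
  | iUnion f hd hm ih =>
    rw [integral_iUnion hm hd hf.integrableOn]
    simp_rw [ih, tsum_zero]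

/-! ### Multiplication operators -/

/-- Dominated convergence: the difference is bounded pointwise by `2 |f|`. -/
lemma tendsto_circleMul {Y : Type*} [MeasurableSpace Y] {μ : Measure Y} {u : ℕ → Y →ₘ[μ] Circle}
    {v : Y →ₘ[μ] Circle} (h : ∀ᵐ y ∂μ, Tendsto (fun n => u n y) atTop (𝓝 (v y)))
    (f : Lp ℂ 2 μ) : Tendsto (fun n => circleMul (u n) f) atTop (𝓝 (circleMul v f)) := by
  rw [Lp.tendsto_Lp_iff_tendsto_eLpNorm']
  have hd : ∀ n, eLpNorm (⇑(circleMul (u n) f) - ⇑(circleMul v f)) 2 μ =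
      (∫⁻ y, ‖((u n y : ℂ) - v y) * f y‖ₑ ^ (2 : ℝ) ∂μ) ^ (1 / (2 : ℝ)) := by
    intro n
    rw [eLpNorm_congr_ae (g := fun y => ((u n y : ℂ) - v y) * f y),
      eLpNorm_eq_lintegral_rpow_enorm_toReal two_ne_zero ENNReal.ofNat_ne_top]
    · simp
    · filter_upwards [coeFn_circleMul (u n) f, coeFn_circleMul v f] with y h1 h2
      rw [Pi.sub_apply, h1, h2, sub_mul]
  simp_rw [hd]
  have hm : ∀ w : Y →ₘ[μ] Circle, AEStronglyMeasurable (fun y => (w y : ℂ)) μ := fun w =>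
    (continuous_subtype_val : Continuous ((↑) : Circle → ℂ)).comp_aestronglyMeasurable
      w.aestronglyMeasurable
  have hb : ∀ n, ∀ y, ‖((u n y : ℂ) - v y) * f y‖ₑ ≤ ‖2 * f y‖ₑ := by
    intro n y
    rw [enorm_le_iff_norm_le, norm_mul, norm_mul]
    refine mul_le_mul_of_nonneg_right ((norm_sub_le _ _).trans ?_) (norm_nonneg _)
    rw [Circle.norm_coe, Circle.norm_coe]
    norm_num
  have hL : Tendsto (fun n => ∫⁻ y, ‖((u n y : ℂ) - v y) * f y‖ₑ ^ (2 : ℝ) ∂μ) atTop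
      (𝓝 (∫⁻ _, 0 ∂μ)) := by
    refine tendsto_lintegral_of_dominated_convergence' (fun y => ‖2 * f y‖ₑ ^ (2 : ℝ))
      (fun n => ?_) (fun n => ae_of_all _ fun y => ?_) ?_ ?_
    · exact ((((hm _).sub (hm _)).mul (Lp.aestronglyMeasurable f)).enorm).pow_const _
    · exact ENNReal.rpow_le_rpow (hb n y) (by norm_num)
    · have h2 : MemLp (fun y => 2 * f y) 2 μ := (Lp.memLp f).const_mul 2
      have := lintegral_rpow_enorm_lt_top_of_eLpNorm_lt_top two_ne_zero ENNReal.ofNat_ne_top h2.2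
      simpa using this.ne
    · filter_upwards [h] with y hy
      have h1 : Tendsto (fun n => ((u n y : ℂ) - v y) * f y) atTop (𝓝 (((v y : ℂ) - v y) * f y)) :=
        (((continuous_subtype_val.tendsto (v y)).comp hy).sub_const _).mul_const _
      rw [sub_self, zero_mul] at h1
      have h2 := (h1.enorm).ennrpow_const (2 : ℝ)
      simpa using h2
  rw [lintegral_zero] at hL
  simpa using hL.ennrpow_const (1 / (2 : ℝ))

/-! ### Step functions on the Cantor space -/

/-- The first `n` digits. -/
def digits (n : ℕ) (a : Cantor) : Fin n → Bool := fun i => a i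

lemma continuous_digits (n : ℕ) : Continuous (digits n) := by
  unfold digits; fun_prop

lemma measurable_digits (n : ℕ) : Measurable (digits n) := (continuous_digits n).measurable

/-- A function of the first `n` digits, as a function of the first `N` digits. -/
def raise {n N : ℕ} (h : n ≤ N) {α : Type*} (c : (Fin n → Bool) → α) (t : Fin N → Bool) : α :=
  c fun i => t (Fin.castLE h i)

/-- The complex step function with values `c`. -/
def stepFun {n : ℕ} (c : (Fin n → Bool) → ℂ) (a : Cantor) : ℂ := c (digits n a)

lemma measurable_stepFun {n : ℕ} (c : (Fin n → Bool) → ℂ) : Measurable (stepFun c) :=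
  (measurable_of_finite c).comp (measurable_digits n)

lemma norm_stepFun_le {n : ℕ} (c : (Fin n → Bool) → ℂ) (a : Cantor) :
    ‖stepFun c a‖ ≤ ∑ t, ‖c t‖ :=
  Finset.single_le_sum (f := fun t => ‖c t‖) (fun _ _ => norm_nonneg _) (Finset.mem_univ _)

lemma memLp_stepFun {n : ℕ} (c : (Fin n → Bool) → ℂ) (p : ℝ≥0∞) : MemLp (stepFun c) p lam :=
  MemLp.of_bound (measurable_stepFun c).aestronglyMeasurable _ (ae_of_all _ (norm_stepFun_le c))

/-- The class in `L²` of a step function. -/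
def stepL2 {n : ℕ} (c : (Fin n → Bool) → ℂ) : Lp ℂ 2 lam := (memLp_stepFun c 2).toLp _

lemma coeFn_stepL2 {n : ℕ} (c : (Fin n → Bool) → ℂ) : stepL2 c =ᵐ[lam] stepFun c :=
  (memLp_stepFun c 2).coeFn_toLp

lemma stepL2_raise {n N : ℕ} (h : n ≤ N) (c : (Fin n → Bool) → ℂ) :
    stepL2 (raise h c) = stepL2 c := rfl

lemma step_raise {n N : ℕ} (h : n ≤ N) (c : (Fin n → Bool) → Circle) :
    step (raise h c) = step c := rfl

lemma map_digits_lam (n : ℕ) :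
    lam.map (digits n) = Measure.pi fun _ => (PMF.uniformOfFintype Bool).toMeasure := by
  have h := Measure.map_infinitePi_infinitePi_of_inj
    (P := fun _ : ℕ => (PMF.uniformOfFintype Bool).toMeasure)
    (f := fun i : Fin n => (i : ℕ)) Fin.val_injective
  exact h.trans (Measure.infinitePi_eq_pi _)

lemma integral_stepFun {n : ℕ} (c : (Fin n → Bool) → ℂ) :
    ∫ a, stepFun c a ∂lam = (∑ t, c t) / 2 ^ n := by
  unfold stepFun
  rw [← integral_map (measurable_digits n).aemeasurable
    (measurable_of_finite c).aestronglyMeasurable, map_digits_lam, integral_fintype .of_finite,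
    Finset.sum_div]
  refine Finset.sum_congr rfl fun t _ => ?_
  have : (Measure.pi fun _ : Fin n => (PMF.uniformOfFintype Bool).toMeasure).real {t} =
      (1 / 2) ^ n := by
    rw [Measure.real, Measure.pi_singleton]
    simp
  rw [this, Complex.real_smul]
  push_cast
  rw [one_div, inv_pow, div_eq_mul_inv, mul_comm]

lemma inner_stepL2 {n : ℕ} (c d : (Fin n → Bool) → ℂ) :
    ⟪stepL2 c, stepL2 d⟫_ℂ = (∑ t, starRingEnd ℂ (c t) * d t) / 2 ^ n := by
  rw [L2.inner_def, ← integral_stepFun]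
  refine integral_congr_ae ?_
  filter_upwards [coeFn_stepL2 c, coeFn_stepL2 d] with a h1 h2
  rw [h1, h2, RCLike.inner_apply, mul_comm]
  rfl

/-- Sets that depend on finitely many digits. -/
def digitSets : Set (Set Cantor) := {A | ∃ (n : ℕ) (B : Set (Fin n → Bool)), digits n ⁻¹' B = A}

lemma exists_digitSet_of_le {n N : ℕ} (h : n ≤ N) (B : Set (Fin n → Bool)) :
    ∃ B' : Set (Fin N → Bool), digits N ⁻¹' B' = digits n ⁻¹' B :=
  ⟨(fun t i => t (Fin.castLE h i)) ⁻¹' B, rfl⟩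

lemma isPiSystem_digitSets : IsPiSystem digitSets := by
  rintro _ ⟨n, B, rfl⟩ _ ⟨m, B', rfl⟩ -
  obtain ⟨D, hD⟩ := exists_digitSet_of_le (le_max_left n m) B
  obtain ⟨D', hD'⟩ := exists_digitSet_of_le (le_max_right n m) B'
  exact ⟨max n m, D ∩ D', by rw [Set.preimage_inter, hD, hD']⟩

lemma univ_mem_digitSets : Set.univ ∈ digitSets := ⟨0, Set.univ, rfl⟩

lemma generateFrom_digitSets :
    (inferInstance : MeasurableSpace Cantor) = MeasurableSpace.generateFrom digitSets := by
  refine le_antisymm ?_ (MeasurableSpace.generateFrom_le ?_)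
  · refine iSup_le fun i => ?_
    rintro _ ⟨s, -, rfl⟩
    refine MeasurableSpace.measurableSet_generateFrom
      ⟨i + 1, (fun t => t (Fin.last i)) ⁻¹' s, rfl⟩
  · rintro _ ⟨n, B, rfl⟩
    exact measurable_digits n B.toFinite.measurableSet

/-- Testing against indicators of digit sets makes the integrals of `v` vanish over a generating
π-system. -/
lemma stepL2_total (v : Lp ℂ 2 lam)
    (h : ∀ i : Σ n : ℕ, (Fin n → Bool) → ℂ, ⟪stepL2 i.2, v⟫_ℂ = 0) : v = 0 := by
  have hv : Integrable v lam := (Lp.memLp v).integrable one_le_two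
  have hB : ∀ S ∈ digitSets, ∫ a in S, v a ∂lam = 0 := by
    rintro _ ⟨n, B, rfl⟩
    have h1 := h ⟨n, B.indicator 1⟩
    rw [L2.inner_def] at h1
    rw [← integral_indicator (measurable_digits n B.toFinite.measurableSet), ← h1]
    refine integral_congr_ae ?_
    filter_upwards [coeFn_stepL2 (B.indicator (1 : (Fin n → Bool) → ℂ))] with a ha
    rw [ha, RCLike.inner_apply, stepFun]
    by_cases hb : digits n a ∈ B <;> simp [Set.indicator, hb]
  refine Lp.ext ((ae_eq_zero_of_setIntegral_piSystem hv generateFrom_digitSets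
    isPiSystem_digitSets ?_ hB).trans (Lp.coeFn_zero ℂ 2 lam).symm)
  simpa using hB _ univ_mem_digitSets

lemma span_stepL2 : (Submodule.span ℂ (Set.range fun i : Σ n : ℕ, (Fin n → Bool) → ℂ =>
    stepL2 i.2)).topologicalClosure = ⊤ :=
  span_closure_eq_top stepL2_total

lemma stepL2_add {n : ℕ} (c d : (Fin n → Bool) → ℂ) : stepL2 (c + d) = stepL2 c + stepL2 d := rfl

lemma stepL2_smul {n : ℕ} (z : ℂ) (c : (Fin n → Bool) → ℂ) : stepL2 (z • c) = z • stepL2 c := rfl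

lemma exists_stepL2_of_mem_span {x : Lp ℂ 2 lam}
    (hx : x ∈ Submodule.span ℂ (Set.range fun i : Σ n : ℕ, (Fin n → Bool) → ℂ => stepL2 i.2)) :
    ∃ (n : ℕ) (c : (Fin n → Bool) → ℂ), stepL2 c = x := by
  induction hx using Submodule.span_induction with
  | mem x hx => obtain ⟨i, rfl⟩ := hx; exact ⟨i.1, i.2, rfl⟩
  | zero => exact ⟨0, 0, rfl⟩
  | add x y _ _ hx hy =>
    obtain ⟨n, c, rfl⟩ := hx
    obtain ⟨m, d, rfl⟩ := hy
    exact ⟨max n m, raise (le_max_left n m) c + raise (le_max_right n m) d, rfl⟩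
  | smul z x _ hx =>
    obtain ⟨n, c, rfl⟩ := hx
    exact ⟨n, z • c, rfl⟩

lemma exists_stepL2_dist_lt (x : Lp ℂ 2 lam) {ε : ℝ} (hε : 0 < ε) :
    ∃ (n : ℕ) (c : (Fin n → Bool) → ℂ), dist (stepL2 c) x < ε := by
  have hx : x ∈ (Submodule.span ℂ (Set.range fun i : Σ n : ℕ, (Fin n → Bool) → ℂ =>
      stepL2 i.2)).topologicalClosure := span_stepL2 ▸ Submodule.mem_top
  obtain ⟨y, hy, hxy⟩ := Metric.mem_closure_iff.1 hx ε hε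
  obtain ⟨n, c, rfl⟩ := exists_stepL2_of_mem_span hy
  exact ⟨n, c, by rwa [dist_comm]⟩

/-! ### Unimodular step functions -/

/-- Projection of the complex plane to the unit circle. -/
def toCircle (z : ℂ) : Circle :=
  if h : z = 0 then 1 else ⟨z / ‖z‖, by simp [Submonoid.unitSphere, h]⟩

lemma tendsto_toCircle {z : ℕ → ℂ} {w : Circle} (h : Tendsto z atTop (𝓝 w)) :
    Tendsto (fun n => toCircle (z n)) atTop (𝓝 w) := by
  refine tendsto_subtype_rng.2 ?_
  have h1 : Tendsto (fun n => z n / ‖z n‖) atTop (𝓝 (w / ‖(w : ℂ)‖)) :=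
    h.div ((Complex.continuous_ofReal.tendsto _).comp h.norm) (by simp)
  simp only [Circle.norm_coe, Complex.ofReal_one, div_one] at h1
  refine h1.congr' ?_
  -- The limit lies on the circle, so the terms are eventually nonzero and the default value of
  -- `toCircle` at 0 plays no role.
  filter_upwards [h.eventually_ne (Circle.coe_ne_zero w)] with n hn
  simp [toCircle, hn]

lemma coeFn_step {n : ℕ} (c : (Fin n → Bool) → Circle) :
    step c =ᵐ[lam] fun a => c (digits n a) := AEEqFun.coeFn_mk _ _

/-- Complex step functions approximate `g` in `L²`; a subsequence converges almost everywhere, and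
radial projection makes its terms unimodular without changing the limit. -/
lemma exists_seq_step_tendsto (g : L0) : ∃ (n : ℕ → ℕ) (c : ∀ k, (Fin (n k) → Bool) → Circle),
    ∀ᵐ a ∂lam, Tendsto (fun k => step (c k) a) atTop (𝓝 (g a)) := by
  have hg : MemLp (fun a => (g a : ℂ)) 2 lam :=
    MemLp.of_bound ((continuous_subtype_val :
      Continuous ((↑) : Circle → ℂ)).comp_aestronglyMeasurable g.aestronglyMeasurable) 1
      (ae_of_all _ fun a => (Circle.norm_coe _).le)
  choose n c hc using fun k : ℕ => exists_stepL2_dist_lt (hg.toLp _)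
    (Nat.one_div_pos_of_nat (α := ℝ) (n := k))
  have hlim : Tendsto (fun k => stepL2 (c k)) atTop (𝓝 (hg.toLp _)) :=
    tendsto_iff_dist_tendsto_zero.2 (squeeze_zero (fun _ => dist_nonneg) (fun k => (hc k).le)
      tendsto_one_div_add_atTop_nhds_zero_nat)
  obtain ⟨φ, -, hφ⟩ := (tendstoInMeasure_of_tendsto_Lp hlim).exists_seq_tendsto_ae
  refine ⟨fun k => n (φ k), fun k t => toCircle (c (φ k) t), ?_⟩
  filter_upwards [hφ, hg.coeFn_toLp, ae_all_iff.2 fun k => coeFn_stepL2 (c (φ k)),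
    ae_all_iff.2 fun k => coeFn_step fun t => toCircle (c (φ k) t)] with a h1 h2 h3 h4
  simp_rw [h4]
  rw [h2] at h1
  simp_rw [h3] at h1
  exact tendsto_toCircle h1

lemma circleMul_step {n : ℕ} (g : (Fin n → Bool) → Circle) (c : (Fin n → Bool) → ℂ) :
    circleMul (step g) (stepL2 c) = stepL2 fun t => (g t : ℂ) * c t := by
  refine Lp.ext ?_
  filter_upwards [coeFn_circleMul (step g) (stepL2 c), coeFn_step g, coeFn_stepL2 c,
    coeFn_stepL2 fun t => (g t : ℂ) * c t] with a h1 h2 h3 h4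
  rw [h1, h2, h3, h4]
  rfl

lemma circleMul_mul {Y : Type*} [MeasurableSpace Y] {μ : Measure Y} (u v : Y →ₘ[μ] Circle)
    (f : Lp ℂ 2 μ) : circleMul (u * v) f = circleMul u (circleMul v f) :=
  congrArg (fun T : Lp ℂ 2 μ ≃ₗᵢ[ℂ] Lp ℂ 2 μ => T f) (map_mul (mulRep μ) u v)

lemma circleMul_one {Y : Type*} [MeasurableSpace Y] {μ : Measure Y}
    (f : Lp ℂ 2 μ) : circleMul (1 : Y →ₘ[μ] Circle) f = f :=
  congrArg (fun T : Lp ℂ 2 μ ≃ₗᵢ[ℂ] Lp ℂ 2 μ => T f) (map_one (mulRep μ))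

/-! ### The topology of convergence in measure -/

lemma tendsto_L0_of_ae {u : ℕ → L0} {g : L0}
    (h : ∀ᵐ a ∂lam, Tendsto (fun n => u n a) atTop (𝓝 (g a))) : Tendsto u atTop (𝓝 g) := by
  rw [tendsto_nhds]
  intro U hU hg
  obtain ⟨ε, hε, hεU⟩ := hU g hg
  have hm := tendstoInMeasure_of_tendsto_ae (fun n => (u n).aestronglyMeasurable) h
  rw [tendstoInMeasure_iff_dist] at hm
  have := (hm ε hε).eventually (gt_mem_nhds (ENNReal.ofReal_pos.2 hε))
  filter_upwards [this] with n hn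
  exact hεU _ hn

/-- If the preimage of an open set were not open at some `g`, there would be points outside it at
distance tending to 0 in measure from `g`; a subsequence converges almost everywhere and contradicts
the hypothesis. No assumption on `Y` is needed. -/
lemma continuous_L0_of_ae {Y : Type*} [TopologicalSpace Y] {F : L0 → Y}
    (h : ∀ (u : ℕ → L0) (g : L0), (∀ᵐ a ∂lam, Tendsto (fun n => u n a) atTop (𝓝 (g a))) →
      Tendsto (fun n => F (u n)) atTop (𝓝 (F g))) : Continuous F := by
  refine continuous_def.2 fun V hV g hg => ?_
  by_contra! hcon
  choose u hu huV using fun n : ℕ => hcon (1 / (n + 1)) Nat.one_div_pos_of_nat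
  have hm : TendstoInMeasure lam (fun n a => u n a) atTop g := by
    rw [tendstoInMeasure_iff_dist]
    intro ε hε
    have h0 : Tendsto (fun n : ℕ => ENNReal.ofReal (1 / ((n : ℝ) + 1))) atTop (𝓝 0) := by
      rw [← ENNReal.ofReal_zero]
      exact (ENNReal.continuous_ofReal.tendsto 0).comp tendsto_one_div_add_atTop_nhds_zero_nat
    refine tendsto_of_tendsto_of_tendsto_of_le_of_le' tendsto_const_nhds h0
      (Eventually.of_forall fun _ => zero_le) ?_
    filter_upwards [tendsto_one_div_add_atTop_nhds_zero_nat.eventually (gt_mem_nhds hε)] with n hn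
    exact (measure_mono fun a ha => hn.le.trans ha).trans (hu n).le
  obtain ⟨φ, -, hφ⟩ := hm.exists_seq_tendsto_ae
  have h1 := (h (fun k => u (φ k)) g hφ).eventually (hV.mem_nhds hg)
  obtain ⟨k, hk⟩ := h1.exists
  exact huV _ hk

/-! ### Linear functionals on the Gaussian space -/

/-- The linear functional on `XInf` that corresponds to the step function with values `c`. -/
def phi {n : ℕ} (c : (Fin n → Bool) → ℂ) (f : XInf) : ℂ :=
  (∑ t, c t * f (List.ofFn t)) / (Real.sqrt 2 : ℂ) ^ n

lemma measurable_coord (s : List Bool) : Measurable fun f : XInf => f s :=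
  (measurable_pi_apply s).comp measurable_subtype_coe

lemma measurable_phi {n : ℕ} (c : (Fin n → Bool) → ℂ) : Measurable (phi c) :=
  (Finset.measurable_sum _ fun _ _ => (measurable_coord _).const_mul _).div_const _

/-- Splitting the sum by the last digit and using the relation `f s = (f (s0) + f (s1)) / √2`
absorbs the extra factor `√2` of the normalization. So `phi` depends only on the step function and
not on the level at which it is written. -/
lemma phi_raise_succ {n N : ℕ} (h : n ≤ N) (h' : n ≤ N + 1) (c : (Fin n → Bool) → ℂ) (f : XInf) :
    phi (raise h' c) f = phi (raise h c) f := by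
  have hs := sqrt_two_ne
  have h2 := sqrt_two_mul
  unfold phi
  rw [← (Fin.snocEquiv fun _ : Fin (N + 1) => Bool).sum_comp, Fintype.sum_prod_type,
    Fintype.sum_bool, add_comm, ← Finset.sum_add_distrib, pow_succ, ← div_div, div_right_comm]
  congr 1
  rw [Finset.sum_div]
  refine Finset.sum_congr rfl fun t _ => ?_
  have hr : ∀ b, raise h' c (Fin.snoc (α := fun _ => Bool) t b) = raise h c t := by
    intro b
    unfold raise
    congr 1
    funext i
    exact Fin.snoc_castSucc (α := fun _ => Bool) b t (Fin.castLE h i)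
  have hl : ∀ b, List.ofFn (Fin.snoc (α := fun _ => Bool) t b) = List.ofFn t ++ [b] := by
    intro b
    rw [List.ofFn_succ']
    simp [List.concat_eq_append]
  change (raise h' c (Fin.snoc (α := fun _ => Bool) t false) *
    f (List.ofFn (Fin.snoc (α := fun _ => Bool) t false)) +
    raise h' c (Fin.snoc (α := fun _ => Bool) t true) *
    f (List.ofFn (Fin.snoc (α := fun _ => Bool) t true))) / _ = _
  rw [hr, hr, hl, hl, f.2 (List.ofFn t)]
  ring

lemma phi_raise {n N : ℕ} (h : n ≤ N) (c : (Fin n → Bool) → ℂ) (f : XInf) :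
    phi (raise h c) f = phi c f := by
  induction N, h using Nat.le_induction with
  | base => rfl
  | succ N hN ih => rw [← ih, phi_raise_succ hN]

/-- The multiple of the indicator function of `[s]` that corresponds to the coordinate `f s`. -/
def coordStep (s : List Bool) : (Fin s.length → Bool) → ℂ :=
  Pi.single s.get ((Real.sqrt 2 : ℂ) ^ s.length)

lemma phi_coordStep (s : List Bool) (f : XInf) : phi (coordStep s) f = f s := by
  have hs := sqrt_two_ne
  unfold phi coordStep
  rw [Finset.sum_eq_single s.get]
  · simp
  · intro t _ ht
    rw [Pi.single_eq_of_ne ht, zero_mul]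
  · simp

lemma stepAct_ofFn {n N : ℕ} (h : n ≤ N) (g : (Fin n → Bool) → Circle) (f : XInf)
    (t : Fin N → Bool) : stepAct g f (List.ofFn t) = ((raise h g t : Circle) : ℂ) * f (List.ofFn t) := by
  change stepActFun g f _ = _
  unfold stepActFun
  rw [if_pos (by simpa using h)]
  congr 3
  funext i
  have hi : (i : ℕ) < N := i.2.trans_le h
  rw [List.getD_eq_getElem _ _ (by simpa using hi)]
  simp [Fin.castLE]

/-- Duality: the action on points moves to multiplication on step functions, which is how
multiplication operators enter. -/
lemma phi_stepAct_of_le {n N : ℕ} (h : n ≤ N) (g : (Fin n → Bool) → Circle)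
    (c : (Fin N → Bool) → ℂ) (f : XInf) :
    phi c (stepAct g f) = phi (fun t => ((raise h g t : Circle) : ℂ) * c t) f := by
  unfold phi
  congr 1
  refine Finset.sum_congr rfl fun t _ => ?_
  rw [stepAct_ofFn h]
  ring

/-! ### Gaussian integrals -/

lemma measurePreserving_restrictLevel (n : ℕ) :
    MeasurePreserving (restrictLevel n) gamInf (Measure.pi fun _ => gam) :=
  ⟨measurable_restrictLevel n, map_restrictLevel_gamInf n⟩

lemma integral_comp_restrictLevel {n : ℕ} {F : ((Fin n → Bool) → ℂ) → ℂ} (hF : Measurable F) :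
    ∫ f, F (restrictLevel n f) ∂gamInf = ∫ z, F z ∂(Measure.pi fun _ => gam) := by
  rw [← map_restrictLevel_gamInf, integral_map (measurable_restrictLevel n).aemeasurable
    hF.aestronglyMeasurable]

lemma measurePreserving_equivRealProd :
    MeasurePreserving Complex.equivRealProdCLM.symm
      ((gaussianReal 0 (1 / 2)).prod (gaussianReal 0 (1 / 2))) gam :=
  ⟨Complex.equivRealProdCLM.symm.continuous.measurable, rfl⟩

lemma measurableEmbedding_equivRealProd : MeasurableEmbedding Complex.equivRealProdCLM.symm :=
  Complex.equivRealProdCLM.symm.toHomeomorph.measurableEmbedding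

/-- The exponent is `a²/4` because the variance is 1/2. Complex `a` is needed for the imaginary part
of a complex Gaussian variable below. -/
lemma exp_gaussian (a : ℂ) : Integrable (fun x : ℝ => Complex.exp (a * x)) (gaussianReal 0 (1 / 2)) ∧
    ∫ x : ℝ, Complex.exp (a * x) ∂gaussianReal 0 (1 / 2) = Complex.exp (a ^ 2 / 4) := by
  constructor
  · have h := integrable_cexp_mul_of_re_mem_integrableExpSet (X := id) (z := a)
      (μ := gaussianReal 0 (1 / 2)) aemeasurable_id
      (by simpa [integrableExpSet] using integrable_exp_mul_gaussianReal a.re)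
    simpa using h
  · have h := complexMGF_id_gaussianReal (μ := 0) (v := 1 / 2) a
    rw [complexMGF] at h
    simp only [id] at h
    rw [h]
    congr 1
    simp
    ring

/-- With `z = x + iy` the exponent is `(a + b) x + i (a - b) y`, and `((a + b)² - (a - b)²) / 4 =
ab`. -/
lemma exp_conj_gam (a b : ℂ) :
    Integrable (fun z : ℂ => Complex.exp (a * z + b * starRingEnd ℂ z)) gam ∧
    ∫ z : ℂ, Complex.exp (a * z + b * starRingEnd ℂ z) ∂gam = Complex.exp (a * b) := by
  have he : ∀ x : ℝ × ℝ, Complex.exp (a * Complex.equivRealProdCLM.symm x +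
      b * starRingEnd ℂ (Complex.equivRealProdCLM.symm x)) =
      Complex.exp ((a + b) * x.1) * Complex.exp (Complex.I * (a - b) * x.2) := by
    intro x
    rw [← Complex.exp_add]
    congr 1
    simp only [Complex.equivRealProdCLM_symm_apply, map_add, map_mul, Complex.conj_ofReal, Complex.conj_I]
    ring
  obtain ⟨h1, h2⟩ := exp_gaussian (a + b)
  obtain ⟨h3, h4⟩ := exp_gaussian (Complex.I * (a - b))
  constructor
  · rw [← measurePreserving_equivRealProd.integrable_comp_emb measurableEmbedding_equivRealProd]
    exact (h1.mul_prod h3).congr (ae_of_all _ fun x => (he x).symm)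
  · rw [← measurePreserving_equivRealProd.integral_comp measurableEmbedding_equivRealProd]
    simp_rw [he]
    rw [integral_prod_mul (fun x : ℝ => Complex.exp ((a + b) * x))
      (fun x : ℝ => Complex.exp (Complex.I * (a - b) * x)), h2, h4, ← Complex.exp_add]
    congr 1
    ring_nf
    rw [Complex.I_sq]
    ring

lemma phi_eq_restrictLevel {n : ℕ} (c d : (Fin n → Bool) → ℂ) (f : XInf) :
    Complex.exp (phi c f + starRingEnd ℂ (phi d f)) =
      ∏ t, Complex.exp ((c t / (Real.sqrt 2 : ℂ) ^ n) * restrictLevel n f t +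
        (starRingEnd ℂ (d t) / (Real.sqrt 2 : ℂ) ^ n) * starRingEnd ℂ (restrictLevel n f t)) := by
  rw [← Complex.exp_sum]
  congr 1
  simp only [phi, map_div₀, map_sum, map_mul, map_pow, Complex.conj_ofReal, restrictLevel,
    Finset.sum_add_distrib, Finset.sum_div]
  congr 1 <;> exact Finset.sum_congr rfl fun t _ => by ring

lemma integrable_exp_phi {n : ℕ} (c d : (Fin n → Bool) → ℂ) :
    Integrable (fun f => Complex.exp (phi c f + starRingEnd ℂ (phi d f))) gamInf := by
  simp_rw [phi_eq_restrictLevel]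
  refine (measurePreserving_restrictLevel n).integrable_comp_of_integrable
    (g := fun z : (Fin n → Bool) → ℂ => ∏ t, Complex.exp ((c t / (Real.sqrt 2 : ℂ) ^ n) * z t +
        (starRingEnd ℂ (d t) / (Real.sqrt 2 : ℂ) ^ n) * starRingEnd ℂ (z t))) ?_
  exact Integrable.fintype_prod (f := fun t (z : ℂ) =>
    Complex.exp ((c t / (Real.sqrt 2 : ℂ) ^ n) * z +
        (starRingEnd ℂ (d t) / (Real.sqrt 2 : ℂ) ^ n) * starRingEnd ℂ z))
    fun t => (exp_conj_gam _ _).1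

/-- The single source for both the characteristic function of `gamInf` and the Gram matrix of the
exponential vectors: independence of the coordinates of a level turns the integral into a product of
one-dimensional ones. -/
lemma integral_exp_phi {n : ℕ} (c d : (Fin n → Bool) → ℂ) :
    ∫ f, Complex.exp (phi c f + starRingEnd ℂ (phi d f)) ∂gamInf =
      Complex.exp ⟪stepL2 d, stepL2 c⟫_ℂ := by
  simp_rw [phi_eq_restrictLevel]
  rw [integral_comp_restrictLevel (F := fun z : (Fin n → Bool) → ℂ =>
      ∏ t, Complex.exp ((c t / (Real.sqrt 2 : ℂ) ^ n) * z t +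
        (starRingEnd ℂ (d t) / (Real.sqrt 2 : ℂ) ^ n) * starRingEnd ℂ (z t))) (by fun_prop),
    integral_fintype_prod_eq_prod (fun t (z : ℂ) =>
    Complex.exp ((c t / (Real.sqrt 2 : ℂ) ^ n) * z +
        (starRingEnd ℂ (d t) / (Real.sqrt 2 : ℂ) ^ n) * starRingEnd ℂ z))]
  simp_rw [(exp_conj_gam _ _).2]
  rw [← Complex.exp_sum, inner_stepL2, Finset.sum_div]
  congr 1
  refine Finset.sum_congr rfl fun t _ => ?_
  rw [div_mul_div_comm, ← mul_pow, sqrt_two_mul, mul_comm (c t)]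

/-! ### Second moments and the Gaussian copy of `L²(λ)` -/

lemma integral_gam_id : ∫ z, z ∂gam = 0 := by
  have h1 : Integrable (fun x : ℝ × ℝ => x)
      ((gaussianReal 0 (1 / 2)).prod (gaussianReal 0 (1 / 2))) :=
    IsGaussian.integrable_id
  have h2 : ∫ x : ℝ × ℝ, x ∂((gaussianReal 0 (1 / 2)).prod (gaussianReal 0 (1 / 2))) = 0 := by
    ext
    · rw [fst_integral h1, integral_fun_fst (f := fun x : ℝ => x)]
      simp [integral_id_gaussianReal]
    · rw [snd_integral h1, integral_fun_snd (f := fun x : ℝ => x)]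
      simp [integral_id_gaussianReal]
  rw [← measurePreserving_equivRealProd.integral_comp measurableEmbedding_equivRealProd,
    ContinuousLinearEquiv.integral_comp_comm, h2, map_zero]

lemma integral_sq_gaussian : ∫ x : ℝ, x ^ 2 ∂gaussianReal 0 (1 / 2) = 1 / 2 := by
  have h := variance_id_gaussianReal (μ := 0) (v := 1 / 2)
  rw [variance_of_integral_eq_zero aemeasurable_id (by simp [integral_id_gaussianReal])] at h
  simpa using h

lemma integral_gam_sq : ∫ z, starRingEnd ℂ z * z ∂gam = 1 := by
  rw [← measurePreserving_equivRealProd.integral_comp measurableEmbedding_equivRealProd]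
  have h1 : ∀ x : ℝ × ℝ, starRingEnd ℂ (Complex.equivRealProdCLM.symm x) *
      Complex.equivRealProdCLM.symm x = ((x.1 ^ 2 + x.2 ^ 2 : ℝ) : ℂ) := by
    intro x
    rw [mul_comm, Complex.mul_conj, Complex.normSq_apply]
    simp [pow_two]
  have hi : Integrable (fun x : ℝ => x ^ 2) (gaussianReal 0 (1 / 2)) :=
    (memLp_id_gaussianReal 2).integrable_sq
  simp_rw [h1]
  rw [integral_complex_ofReal, integral_add (hi.comp_fst _) (hi.comp_snd _),
    integral_fun_fst (f := fun x : ℝ => x ^ 2), integral_fun_snd (f := fun x : ℝ => x ^ 2),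
    integral_sq_gaussian]
  norm_num

lemma integral_pi_gam {ι : Type*} [Fintype ι] [DecidableEq ι] (s t : ι) :
    ∫ z : ι → ℂ, starRingEnd ℂ (z s) * z t ∂(Measure.pi fun _ => gam) = if s = t then 1 else 0 := by
  split_ifs with h
  · subst h
    rw [← integral_gam_sq]
    exact integral_comp_eval (μ := fun _ : ι => gam) (i := s)
      (f := fun z => starRingEnd ℂ z * z) (by fun_prop)
  · have h1 : ∀ z : ι → ℂ, starRingEnd ℂ (z s) * z t =
        ∏ r, ((if r = s then starRingEnd ℂ (z r) else 1) * if r = t then z r else 1) := by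
      intro z
      rw [Finset.prod_mul_distrib]
      simp
    simp_rw [h1]
    rw [integral_fintype_prod_eq_prod (fun r (z : ℂ) =>
      (if r = s then starRingEnd ℂ z else 1) * if r = t then z else 1)]
    refine Finset.prod_eq_zero (Finset.mem_univ t) ?_
    simp [Ne.symm h, integral_gam_id]

lemma memLp_coord {n : ℕ} (t : Fin n → Bool) :
    MemLp (fun f : XInf => f (List.ofFn t)) 2 gamInf := by
  have h1 := (measurePreserving_eval (fun _ : Fin n → Bool => gam) t).comp
    (measurePreserving_restrictLevel n)
  exact (IsGaussian.memLp_id gam 2 (by simp)).comp_measurePreserving h1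

lemma memLp_phi {n : ℕ} (c : (Fin n → Bool) → ℂ) : MemLp (phi c) 2 gamInf := by
  unfold phi
  simp_rw [div_eq_mul_inv]
  exact (memLp_finsetSum _ fun t _ => (memLp_coord t).const_mul _).mul_const _

/-- The class of `phi c` in `L²`. -/
def phiL2 {n : ℕ} (c : (Fin n → Bool) → ℂ) : Lp ℂ 2 gamInf := (memLp_phi c).toLp _

lemma coeFn_phiL2 {n : ℕ} (c : (Fin n → Bool) → ℂ) : phiL2 c =ᵐ[gamInf] phi c :=
  (memLp_phi c).coeFn_toLp

lemma phiL2_raise {n N : ℕ} (h : n ≤ N) (c : (Fin n → Bool) → ℂ) :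
    phiL2 (raise h c) = phiL2 c := by
  unfold phiL2
  congr 1
  exact funext (phi_raise h c)

/-- The coordinates of level `n` are orthonormal in `L²(γ∞)`, so the Gram matrix is the one found in
`inner_stepL2`. -/
lemma inner_phiL2 {n : ℕ} (c d : (Fin n → Bool) → ℂ) :
    ⟪phiL2 c, phiL2 d⟫_ℂ = (∑ t, starRingEnd ℂ (c t) * d t) / 2 ^ n := by
  have h1 : ⟪phiL2 c, phiL2 d⟫_ℂ = ∫ f, ∑ s, ∑ t, (starRingEnd ℂ (c s) * d t / 2 ^ n) *
      (starRingEnd ℂ (f (List.ofFn s)) * f (List.ofFn t)) ∂gamInf := by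
    rw [L2.inner_def]
    refine integral_congr_ae ?_
    filter_upwards [coeFn_phiL2 c, coeFn_phiL2 d] with f h1 h2
    rw [h1, h2, RCLike.inner_apply, mul_comm]
    simp only [phi, map_div₀, map_sum, map_mul, map_pow, Complex.conj_ofReal]
    rw [div_mul_div_comm, ← mul_pow, sqrt_two_mul, Finset.sum_mul_sum, Finset.sum_div]
    refine Finset.sum_congr rfl fun s _ => ?_
    rw [Finset.sum_div]
    exact Finset.sum_congr rfl fun t _ => by ring
  have hint : ∀ s t : Fin n → Bool, Integrable (fun f : XInf => (starRingEnd ℂ (c s) * d t / 2 ^ n) *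
      (starRingEnd ℂ (f (List.ofFn s)) * f (List.ofFn t))) gamInf := fun s t =>
    (MemLp.integrable_mul (memLp_coord s).star (memLp_coord t)).const_mul _
  have hval : ∀ s t : Fin n → Bool,
      ∫ f : XInf, starRingEnd ℂ (f (List.ofFn s)) * f (List.ofFn t) ∂gamInf =
        if s = t then 1 else 0 := by
    intro s t
    rw [← integral_pi_gam s t]
    exact integral_comp_restrictLevel (F := fun z => starRingEnd ℂ (z s) * z t) (by fun_prop)
  rw [h1, integral_finsetSum _ fun s _ => integrable_finsetSum _ fun t _ => hint s t,
    Finset.sum_div]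
  refine Finset.sum_congr rfl fun s _ => ?_
  rw [integral_finsetSum _ fun t _ => hint s t]
  simp_rw [integral_const_mul, hval]
  simp

lemma exists_gaussianEmbedding : ∃ W : Lp ℂ 2 lam →ₗᵢ[ℂ] Lp ℂ 2 gamInf,
    ∀ i : Σ n : ℕ, (Fin n → Bool) → ℂ, W (stepL2 i.2) = phiL2 i.2 := by
  refine exists_linearIsometry_of_inner_eq (fun i j => ?_) span_stepL2
  rw [← stepL2_raise (le_max_left i.1 j.1) i.2, ← stepL2_raise (le_max_right i.1 j.1) j.2,
    ← phiL2_raise (le_max_left i.1 j.1) i.2, ← phiL2_raise (le_max_right i.1 j.1) j.2,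
    inner_stepL2, inner_phiL2]

/-- The isometric embedding of `L²` of the Cantor space into the Gaussian `L²` space. -/
def W : Lp ℂ 2 lam →ₗᵢ[ℂ] Lp ℂ 2 gamInf := exists_gaussianEmbedding.choose

lemma W_stepL2 {n : ℕ} (c : (Fin n → Bool) → ℂ) : W (stepL2 c) = phiL2 c :=
  exists_gaussianEmbedding.choose_spec ⟨n, c⟩

/-! ### Characters of the Gaussian space -/

/-- The character `z ↦ exp (i Re z)` of the complex plane. -/
def cis (z : ℂ) : ℂ := Complex.exp (Complex.I * z.re)

lemma norm_cis (z : ℂ) : ‖cis z‖ = 1 := by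
  rw [cis, mul_comm]; exact Complex.norm_exp_ofReal_mul_I _

lemma measurable_cis : Measurable cis := by unfold cis; fun_prop

lemma cis_neg (z : ℂ) : cis (-z) = starRingEnd ℂ (cis z) := by
  simp [cis, ← Complex.exp_conj]

/-- A Lipschitz function with value 0 at 0 that differs from `cis` by a constant. -/
def cisSub (z : ℂ) : ℂ := cis z - 1

lemma cisSub_zero : cisSub 0 = 0 := by simp [cisSub, cis]

lemma lipschitzWith_cisSub : LipschitzWith 1 cisSub := by
  refine LipschitzWith.of_dist_le_mul fun z w => ?_
  rw [dist_eq_norm, dist_eq_norm, cisSub, cisSub, sub_sub_sub_cancel_right]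
  have h : cis z - cis w = cis w * (Complex.exp (Complex.I * ((z.re - w.re : ℝ) : ℂ)) - 1) := by
    rw [mul_sub, cis, cis, ← Complex.exp_add, mul_one]
    congr 2
    push_cast
    ring
  rw [h, norm_mul, norm_cis, one_mul, NNReal.coe_one, one_mul]
  refine (Real.norm_exp_I_mul_ofReal_sub_one_le).trans ?_
  rw [← Complex.sub_re]
  exact Complex.abs_re_le_norm _

/-- The identity `i Re w = (i/2) w + conj (-(i/2) w)` writes a character as an exponential of the
kind integrated in `integral_exp_phi`. -/
lemma cis_phi {n : ℕ} (c : (Fin n → Bool) → ℂ) (f : XInf) :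
    cis (phi c f) = Complex.exp (phi ((Complex.I / 2) • c) f +
      starRingEnd ℂ (phi ((-(Complex.I / 2)) • c) f)) := by
  have hsm : ∀ z : ℂ, phi (z • c) f = z * phi c f := by
    intro z
    simp only [phi, Pi.smul_apply, smul_eq_mul, mul_assoc, ← Finset.mul_sum, mul_div_assoc]
  rw [hsm, hsm, cis]
  congr 1
  rw [Complex.re_eq_add_conj]
  have h2 : starRingEnd ℂ (2 : ℂ) = 2 := map_ofNat _ 2
  simp [h2]
  ring

lemma integral_cis_phi {n : ℕ} (c : (Fin n → Bool) → ℂ) :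
    ∫ f, cis (phi c f) ∂gamInf = Complex.exp (-(‖stepL2 c‖ ^ 2 / 4 : ℝ)) := by
  simp_rw [cis_phi]
  rw [integral_exp_phi, stepL2_smul, stepL2_smul, inner_smul_left, inner_smul_right,
    inner_self_eq_norm_sq_to_K]
  congr 1
  have h2 : starRingEnd ℂ (2 : ℂ) = 2 := map_ofNat _ 2
  simp [h2]
  ring_nf
  rw [Complex.I_sq]
  ring

lemma integrable_cis {X : Type*} [MeasurableSpace X] {μ : Measure X} [IsFiniteMeasure μ]
    {u : X → ℂ} (hu : AEStronglyMeasurable u μ) : Integrable (fun x => cis (u x)) μ :=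
  (integrable_const (1 : ℂ)).mono
    ((by unfold cis; fun_prop : Continuous cis).comp_aestronglyMeasurable hu)
    (ae_of_all _ fun x => by simp [norm_cis])

/-- For step functions this is `integral_cis_phi`, and both sides are continuous in `h`. Subtracting
1 gives a Lipschitz function vanishing at 0, for which composition is continuous on `L²`. -/
lemma integral_cisSub_W (h : Lp ℂ 2 lam) :
    ∫ f, cisSub (W h f) ∂gamInf = Complex.exp (-(‖h‖ ^ 2 / 4 : ℝ)) - 1 := by
  have hi : ∀ x : Lp ℂ 2 gamInf, ∫ f, cisSub (x f) ∂gamInf =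
      ⟪Lp.const 2 gamInf (1 : ℂ), lipschitzWith_cisSub.compLp cisSub_zero x⟫_ℂ := by
    intro x
    rw [L2.inner_def]
    refine integral_congr_ae ?_
    filter_upwards [Lp.coeFn_const (p := 2) (μ := gamInf) (1 : ℂ),
      lipschitzWith_cisSub.coeFn_compLp cisSub_zero x] with f h1 h2
    rw [h1, h2]
    simp
  have hd : Dense (Set.range fun i : Σ n : ℕ, (Fin n → Bool) → ℂ => stepL2 i.2) := by
    intro x
    rw [Metric.mem_closure_iff]
    intro ε hε
    obtain ⟨n, c, hc⟩ := exists_stepL2_dist_lt x hε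
    exact ⟨_, ⟨⟨n, c⟩, rfl⟩, by rwa [dist_comm]⟩
  have hc1 : Continuous fun h : Lp ℂ 2 lam => ∫ f, cisSub (W h f) ∂gamInf := by
    simp_rw [hi]
    have := lipschitzWith_cisSub.continuous_compLp (p := 2) (μ := gamInf) cisSub_zero
    exact continuous_const.inner (this.comp W.continuous)
  have hc2 : Continuous fun h : Lp ℂ 2 lam => Complex.exp (-(‖h‖ ^ 2 / 4 : ℝ)) - 1 := by fun_prop
  refine congrFun (hc1.ext_on hd hc2 ?_) h
  rintro _ ⟨⟨n, c⟩, rfl⟩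
  have hW := W_stepL2 c
  simp only [hW]
  rw [← integral_cis_phi]
  have h1 : ∫ f, cisSub (phiL2 c f) ∂gamInf = ∫ f, (cis (phi c f) - 1) ∂gamInf := by
    refine integral_congr_ae ?_
    filter_upwards [coeFn_phiL2 c] with f hf
    rw [hf, cisSub]
  rw [h1, integral_sub (integrable_cis (measurable_phi c).aestronglyMeasurable)
    (integrable_const _)]
  simp

/-! ### Measures on the Gaussian space -/

/-- Sets that depend on the values on one level. -/
def levelSets : Set (Set XInf) :=
  {S | ∃ (n : ℕ) (A : Set ((Fin n → Bool) → ℂ)), MeasurableSet A ∧ restrictLevel n ⁻¹' A = S}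

lemma exists_levelSet_of_le {n N : ℕ} (h : n ≤ N) {A : Set ((Fin n → Bool) → ℂ)}
    (hA : MeasurableSet A) : ∃ A' : Set ((Fin N → Bool) → ℂ), MeasurableSet A' ∧
      restrictLevel N ⁻¹' A' = restrictLevel n ⁻¹' A := by
  classical
  -- `D` recovers the coordinates of level `n` from those of level `N`: the coordinate `s` is `phi`
  -- of a multiple of the indicator of `[s]`, rewritten at level `N`.
  let D : ((Fin N → Bool) → ℂ) → (Fin n → Bool) → ℂ := fun y s =>
    (∑ t, raise h (Pi.single s ((Real.sqrt 2 : ℂ) ^ n)) t * y t) / (Real.sqrt 2 : ℂ) ^ N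
  have hD : Measurable D := by fun_prop
  refine ⟨D ⁻¹' A, hD hA, ?_⟩
  rw [← Set.preimage_comp]
  congr 1
  funext f s
  have h1 := phi_raise h (Pi.single s ((Real.sqrt 2 : ℂ) ^ n)) f
  refine h1.trans ?_
  rw [phi, Finset.sum_eq_single s]
  · have := sqrt_two_ne
    simp [restrictLevel]
  · intro t _ ht
    rw [Pi.single_eq_of_ne ht, zero_mul]
  · simp

lemma isPiSystem_levelSets : IsPiSystem levelSets := by
  rintro _ ⟨n, A, hA, rfl⟩ _ ⟨m, B, hB, rfl⟩ -
  obtain ⟨A', hA', h1⟩ := exists_levelSet_of_le (le_max_left n m) hA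
  obtain ⟨B', hB', h2⟩ := exists_levelSet_of_le (le_max_right n m) hB
  exact ⟨_, A' ∩ B', hA'.inter hB', by rw [Set.preimage_inter, h1, h2]⟩

lemma generateFrom_levelSets :
    (inferInstance : MeasurableSpace XInf) = MeasurableSpace.generateFrom levelSets := by
  refine le_antisymm ?_ (MeasurableSpace.generateFrom_le ?_)
  · have h1 : @Measurable _ _ (MeasurableSpace.generateFrom levelSets) _
        (Subtype.val : XInf → List Bool → ℂ) := by
      refine @measurable_pi_lambda _ _ _ (MeasurableSpace.generateFrom levelSets) _ _ fun s => ?_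
      intro A hA
      refine MeasurableSpace.measurableSet_generateFrom
        ⟨s.length, (fun y => y s.get) ⁻¹' A, measurable_pi_apply _ hA, ?_⟩
      ext f
      simp [restrictLevel]
    exact h1.comap_le
  · rintro _ ⟨n, A, hA, rfl⟩
    exact measurable_restrictLevel n hA

lemma dual_eq_re {n : ℕ} (L : StrongDual ℝ ((Fin n → Bool) → ℂ)) :
    ∃ c : (Fin n → Bool) → ℂ, ∀ f : XInf, L (restrictLevel n f) = (phi c f).re := by
  -- A real-linear `L` is the real part of the complex-linear functional with coefficients `L(e_t) -
  -- i L(i e_t)`; the power of `√2` undoes the normalization of `phi`.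
  refine ⟨fun t => (Real.sqrt 2 : ℂ) ^ n *
    ((L (Pi.single t 1) : ℂ) - L (Pi.single t Complex.I) * Complex.I), fun f => ?_⟩
  have hs := sqrt_two_ne
  have h1 : restrictLevel n f = ∑ t, ((restrictLevel n f t).re • (Pi.single t 1 : (Fin n → Bool) → ℂ) +
      (restrictLevel n f t).im • (Pi.single t Complex.I : (Fin n → Bool) → ℂ)) := by
    refine (Finset.univ_sum_single (restrictLevel n f)).symm.trans
      (Finset.sum_congr rfl fun t _ => ?_)
    rw [← Pi.single_smul, ← Pi.single_smul, ← Pi.single_add]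
    congr 1
    simp [Complex.re_add_im]
  rw [h1, map_sum, phi, Finset.sum_div, Complex.re_sum]
  refine Finset.sum_congr rfl fun t _ => ?_
  rw [map_add, map_smul, map_smul, mul_assoc, mul_div_cancel_left₀ _ (pow_ne_zero _ hs)]
  simp [restrictLevel]
  ring

/-- On each level these integrals are the characteristic function of a finite-dimensional image
measure, and the level sets form a generating π-system. -/
lemma ext_of_integral_cis {μ ν : Measure XInf} [IsFiniteMeasure μ] [IsFiniteMeasure ν]
    (h : ∀ (n : ℕ) (c : (Fin n → Bool) → ℂ),
      ∫ f, cis (phi c f) ∂μ = ∫ f, cis (phi c f) ∂ν) : μ = ν := by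
  have hm : ∀ n, μ.map (restrictLevel n) = ν.map (restrictLevel n) := by
    intro n
    refine Measure.ext_of_charFunDual (funext fun L => ?_)
    obtain ⟨c, hc⟩ := dual_eq_re L
    rw [charFunDual_apply, charFunDual_apply,
      integral_map (measurable_restrictLevel n).aemeasurable (by fun_prop),
      integral_map (measurable_restrictLevel n).aemeasurable (by fun_prop)]
    simp_rw [hc, mul_comm _ Complex.I]
    exact h n c
  refine ext_of_generate_finite levelSets generateFrom_levelSets isPiSystem_levelSets ?_ ?_
  · rintro _ ⟨n, A, hA, rfl⟩
    rw [← Measure.map_apply (measurable_restrictLevel n) hA, hm,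
      Measure.map_apply (measurable_restrictLevel n) hA]
  · rw [← Set.preimage_univ (f := restrictLevel 0),
      ← Measure.map_apply (measurable_restrictLevel 0) .univ, hm,
      Measure.map_apply (measurable_restrictLevel 0) .univ]

/-- The positive and the negative part of `u` are densities of two finite measures with the same
characteristic function, hence of the same measure. -/
lemma ae_eq_zero_of_integral_cis_real {u : XInf → ℝ} (hu : Integrable u gamInf)
    (h : ∀ (n : ℕ) (c : (Fin n → Bool) → ℂ), ∫ f, (u f : ℂ) * cis (phi c f) ∂gamInf = 0) :
    u =ᵐ[gamInf] 0 := by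
  have hm : ∀ v : XInf → ℝ, Integrable v gamInf →
      AEMeasurable (fun f => ENNReal.ofReal (v f)) gamInf :=
    fun v hv => hv.aestronglyMeasurable.aemeasurable.ennreal_ofReal
  have hfin : ∀ v : XInf → ℝ, Integrable v gamInf →
      IsFiniteMeasure (gamInf.withDensity fun f => ENNReal.ofReal (v f)) :=
    fun v hv => isFiniteMeasure_withDensity_ofReal hv.2
  have hint : ∀ v : XInf → ℝ, Integrable v gamInf → ∀ (n : ℕ) (c : (Fin n → Bool) → ℂ),
      ∫ f, cis (phi c f) ∂(gamInf.withDensity fun f => ENNReal.ofReal (v f)) =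
        ∫ f, ((max (v f) 0 : ℝ) : ℂ) * cis (phi c f) ∂gamInf := by
    intro v hv n c
    rw [integral_withDensity_eq_integral_toReal_smul₀ (hm v hv) (by simp)]
    simp [ENNReal.toReal_ofReal']
  have hbd : ∀ v : XInf → ℝ, Integrable v gamInf → ∀ (n : ℕ) (c : (Fin n → Bool) → ℂ),
      Integrable (fun f => (v f : ℂ) * cis (phi c f)) gamInf := by
    intro v hv n c
    refine hv.ofReal.mul_bdd (c := 1)
      (measurable_cis.comp (measurable_phi c)).aestronglyMeasurable (ae_of_all _ fun f => ?_)
    exact (norm_cis _).le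
  have := hfin u hu
  have := hfin _ hu.neg
  have heq : (gamInf.withDensity fun f => ENNReal.ofReal (u f)) =
      gamInf.withDensity fun f => ENNReal.ofReal ((-u) f) := by
    refine ext_of_integral_cis fun n c => ?_
    rw [hint u hu, hint _ hu.neg, ← sub_eq_zero,
      ← integral_sub (hbd _ hu.pos_part n c) (hbd _ hu.neg.pos_part n c), ← h n c]
    refine integral_congr_ae (ae_of_all _ fun f => ?_)
    simp only
    rw [← sub_mul, ← Complex.ofReal_sub]
    congr 2
    have : (-u) f = - u f := rfl
    rw [this]
    rcases le_total (u f) 0 with h0 | h0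
    · rw [max_eq_right h0, max_eq_left (by linarith)]; ring
    · rw [max_eq_left h0, max_eq_right (by linarith)]; ring
  rw [withDensity_eq_iff_of_sigmaFinite (hm _ hu) (hm _ hu.neg)] at heq
  filter_upwards [heq] with f hf
  have hneg : (-u) f = - u f := rfl
  rw [hneg] at hf
  rcases lt_trichotomy (u f) 0 with h0 | h0 | h0
  · rw [ENNReal.ofReal_of_nonpos h0.le, eq_comm, ENNReal.ofReal_eq_zero] at hf
    simp only [Pi.zero_apply]; linarith
  · exact h0
  · rw [ENNReal.ofReal_of_nonpos (neg_nonpos.2 h0.le), ENNReal.ofReal_eq_zero] at hf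
    simp only [Pi.zero_apply]; linarith

/-- Conjugating the hypothesis at `-c` shows that the conjugate of `v` satisfies it too, so the real
and imaginary parts can be treated separately. -/
lemma ae_eq_zero_of_integral_cis {v : XInf → ℂ} (hv : Integrable v gamInf)
    (h : ∀ (n : ℕ) (c : (Fin n → Bool) → ℂ), ∫ f, v f * cis (phi c f) ∂gamInf = 0) :
    v =ᵐ[gamInf] 0 := by
  have hneg : ∀ (n : ℕ) (c : (Fin n → Bool) → ℂ) (f : XInf), phi (-c) f = - phi c f := by
    intro n c f
    simp [phi, neg_div]
  have hconj : ∀ (n : ℕ) (c : (Fin n → Bool) → ℂ),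
      ∫ f, starRingEnd ℂ (v f) * cis (phi c f) ∂gamInf = 0 := by
    intro n c
    have h1 := congrArg (starRingEnd ℂ) (h n (-c))
    rw [← integral_conj, map_zero] at h1
    simpa [hneg, cis_neg] using h1
  have hbd : ∀ w : XInf → ℂ, Integrable w gamInf → ∀ (n : ℕ) (c : (Fin n → Bool) → ℂ),
      Integrable (fun f => w f * cis (phi c f)) gamInf := by
    intro v hv n c
    refine hv.mul_bdd (c := 1)
      (measurable_cis.comp (measurable_phi c)).aestronglyMeasurable (ae_of_all _ fun f => ?_)
    exact (norm_cis _).le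
  have hv' : Integrable (fun f => starRingEnd ℂ (v f)) gamInf :=
    (LinearIsometryEquiv.integrable_comp_iff Complex.conjLIE).2 hv
  have hre : (fun f => (v f).re) =ᵐ[gamInf] 0 := by
    refine ae_eq_zero_of_integral_cis_real hv.re fun n c => ?_
    have : ∀ f, ((v f).re : ℂ) * cis (phi c f) =
        (v f * cis (phi c f) + starRingEnd ℂ (v f) * cis (phi c f)) / 2 := by
      intro f
      rw [Complex.re_eq_add_conj]; ring
    simp_rw [this]
    rw [integral_div, integral_add (hbd _ hv n c) (hbd _ hv' n c), h, hconj]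
    simp
  have him : (fun f => (v f).im) =ᵐ[gamInf] 0 := by
    refine ae_eq_zero_of_integral_cis_real hv.im fun n c => ?_
    have : ∀ f, ((v f).im : ℂ) * cis (phi c f) =
        (v f * cis (phi c f) - starRingEnd ℂ (v f) * cis (phi c f)) / (2 * Complex.I) := by
      intro f
      rw [Complex.im_eq_sub_conj]; ring
    simp_rw [this]
    rw [integral_div, integral_sub (hbd _ hv n c) (hbd _ hv' n c), h, hconj]
    simp
  filter_upwards [hre, him] with f h1 h2
  exact Complex.ext h1 h2

/-! ### Construction of the action -/

lemma coeFn_sum_smul {ι X : Type*} [Fintype ι] [MeasurableSpace X] {μ : Measure X} (a : ι → ℂ)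
    (x : ι → Lp ℂ 2 μ) : ⇑(∑ i, a i • x i) =ᵐ[μ] fun f => ∑ i, a i * x i f := by
  filter_upwards [Lp.coeFn_fun_finsetSum Finset.univ fun i => a i • x i,
    ae_all_iff.2 fun i => Lp.coeFn_smul (a i) (x i)] with f h1 h2
  rw [h1]
  exact Finset.sum_congr rfl fun i _ => h2 i

/-- The element of `L²` of the Cantor space that corresponds to a coordinate. -/
def coordL2 (s : List Bool) : Lp ℂ 2 lam := stepL2 (coordStep s)

lemma W_coordL2 (s : List Bool) : W (coordL2 s) =ᵐ[gamInf] fun f => f s := by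
  rw [coordL2, W_stepL2]
  refine (coeFn_phiL2 _).trans (ae_of_all _ fun f => phi_coordStep s f)

/-- The defining relation of `XInf`, pulled back to `L²(λ)` by injectivity of `W`. -/
lemma coordL2_eq (s : List Bool) : coordL2 s =
    (1 / (Real.sqrt 2 : ℂ)) • coordL2 (s ++ [false]) +
      (1 / (Real.sqrt 2 : ℂ)) • coordL2 (s ++ [true]) := by
  refine W.injective (Lp.ext ?_)
  rw [map_add, map_smul, map_smul]
  filter_upwards [W_coordL2 s, W_coordL2 (s ++ [false]), W_coordL2 (s ++ [true]),
    Lp.coeFn_add ((1 / (Real.sqrt 2 : ℂ)) • W (coordL2 (s ++ [false])))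
      ((1 / (Real.sqrt 2 : ℂ)) • W (coordL2 (s ++ [true]))),
    Lp.coeFn_smul (1 / (Real.sqrt 2 : ℂ)) (W (coordL2 (s ++ [false]))),
    Lp.coeFn_smul (1 / (Real.sqrt 2 : ℂ)) (W (coordL2 (s ++ [true])))] with f h1 h2 h3 h4 h5 h6
  rw [h1, h4, Pi.add_apply, h5, h6, Pi.smul_apply, Pi.smul_apply, h2, h3, f.2 s, smul_eq_mul,
    smul_eq_mul]
  ring

lemma stepL2_eq_sum {n : ℕ} (c : (Fin n → Bool) → ℂ) :
    stepL2 c = ∑ t, (c t / (Real.sqrt 2 : ℂ) ^ n) • coordL2 (List.ofFn t) := by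
  refine W.injective (Lp.ext ?_)
  simp_rw [map_sum, map_smul]
  rw [W_stepL2]
  filter_upwards [coeFn_phiL2 c, coeFn_sum_smul (fun t => c t / (Real.sqrt 2 : ℂ) ^ n)
    fun t => W (coordL2 (List.ofFn t)), ae_all_iff.2 fun t : Fin n → Bool =>
      W_coordL2 (List.ofFn t)] with f h1 h2 h3
  rw [h1, h2, phi, Finset.sum_div]
  refine Finset.sum_congr rfl fun t _ => ?_
  rw [h3 t]
  ring

/-- The coordinate `s` of the image of a point under `g`. -/
def coordFun (g : L0) (s : List Bool) (f : XInf) : ℂ := W (circleMul g (coordL2 s)) f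

lemma measurable_coordFun (g : L0) (s : List Bool) : Measurable (coordFun g s) :=
  (Lp.stronglyMeasurable _).measurable

/-- The set of points where the functions `coordFun g` define a point of `XInf`. -/
def goodSet (g : L0) : Set XInf := {f | ∀ s, coordFun g s f =
  (coordFun g (s ++ [false]) f + coordFun g (s ++ [true]) f) / (Real.sqrt 2 : ℂ)}

lemma measurableSet_goodSet (g : L0) : MeasurableSet (goodSet g) := by
  rw [goodSet, Set.ofPred_forall]
  refine MeasurableSet.iInter fun s => measurableSet_eq_fun (measurable_coordFun g s) ?_
  exact ((measurable_coordFun g _).add (measurable_coordFun g _)).div_const _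

/-- The relation of `coordL2_eq` survives multiplication by `g` and the linear map `W`, and there
are only countably many `s`. -/
lemma ae_mem_goodSet (g : L0) : ∀ᵐ f ∂gamInf, f ∈ goodSet g := by
  refine ae_all_iff.2 fun s => ?_
  have h : W (circleMul g (coordL2 s)) =
      (1 / (Real.sqrt 2 : ℂ)) • W (circleMul g (coordL2 (s ++ [false]))) +
      (1 / (Real.sqrt 2 : ℂ)) • W (circleMul g (coordL2 (s ++ [true]))) := by
    rw [coordL2_eq s, map_add, map_smul, map_smul, map_add, map_smul, map_smul]
  filter_upwards [Lp.coeFn_add ((1 / (Real.sqrt 2 : ℂ)) • W (circleMul g (coordL2 (s ++ [false]))))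
      ((1 / (Real.sqrt 2 : ℂ)) • W (circleMul g (coordL2 (s ++ [true])))),
    Lp.coeFn_smul (1 / (Real.sqrt 2 : ℂ)) (W (circleMul g (coordL2 (s ++ [false])))),
    Lp.coeFn_smul (1 / (Real.sqrt 2 : ℂ)) (W (circleMul g (coordL2 (s ++ [true]))))]
    with f h4 h5 h6
  unfold coordFun
  rw [h, h4, Pi.add_apply, h5, h6, Pi.smul_apply, Pi.smul_apply, smul_eq_mul, smul_eq_mul]
  ring

open Classical in
/-- The transformation of `XInf` defined by `g`. -/
def actFun (g : L0) (f : XInf) : XInf :=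
  -- Off the good set, which has full measure, the identity is used so that the value is always a
  -- point of `XInf`.
  ⟨fun s => if f ∈ goodSet g then coordFun g s f else f s, fun s => by
    split_ifs with h
    · exact h s
    · exact f.2 s⟩

lemma measurable_actFun (g : L0) : Measurable (actFun g) :=
  Measurable.subtype_mk (measurable_pi_lambda _ fun s =>
    Measurable.ite (measurableSet_goodSet g) (measurable_coordFun g s) (measurable_coord s))

lemma actFun_coord (g : L0) : ∀ᵐ f ∂gamInf, ∀ s, actFun g f s = coordFun g s f := by
  filter_upwards [ae_mem_goodSet g] with f hf s
  exact if_pos hf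

lemma phi_actFun (g : L0) {n : ℕ} (c : (Fin n → Bool) → ℂ) :
    (fun f => phi c (actFun g f)) =ᵐ[gamInf] W (circleMul g (stepL2 c)) := by
  rw [stepL2_eq_sum]
  simp_rw [map_sum, map_smul]
  filter_upwards [actFun_coord g, coeFn_sum_smul (fun t => c t / (Real.sqrt 2 : ℂ) ^ n)
    fun t => W (circleMul g (coordL2 (List.ofFn t)))] with f h1 h2
  rw [h2, phi, Finset.sum_div]
  refine Finset.sum_congr rfl fun t _ => ?_
  rw [h1, coordFun]
  ring

/-- Composing `phi c` with the map gives `W (g c)`; its characteristic function depends only on `‖g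
c‖ = ‖c‖`, and these integrals determine the measure. -/
lemma measurePreserving_actFun (g : L0) : MeasurePreserving (actFun g) gamInf gamInf := by
  refine ⟨measurable_actFun g, ?_⟩
  have : IsProbabilityMeasure (gamInf.map (actFun g)) :=
    Measure.isProbabilityMeasure_map (measurable_actFun g).aemeasurable
  refine ext_of_integral_cis fun n c => ?_
  have hc : Measurable fun f => cis (phi c f) := measurable_cis.comp (measurable_phi c)
  rw [integral_map (measurable_actFun g).aemeasurable hc.aestronglyMeasurable, integral_cis_phi]
  have h1 := integral_cisSub_W (circleMul g (stepL2 c))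
  unfold cisSub at h1
  rw [integral_sub (integrable_cis (Lp.aestronglyMeasurable _)) (integrable_const _),
    LinearIsometry.norm_map] at h1
  simp only [integral_const, probReal_univ, one_smul] at h1
  rw [← sub_left_inj.1 h1]
  refine integral_congr_ae ?_
  filter_upwards [phi_actFun g c] with f hf
  rw [hf]

/-- The class of `actFun g`. -/
def actMap (g : L0) : MPMap gamInf :=
  ⟨AEEqFun.mk (actFun g) (measurable_actFun g).aestronglyMeasurable,
    (measurePreserving_actFun g).congr (AEEqFun.stronglyMeasurable _).measurable
      (AEEqFun.coeFn_mk _ _).symm⟩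

lemma coeFn_actMap (g : L0) : actMap g =ᵐ[gamInf] actFun g := AEEqFun.coeFn_mk _ _

lemma actMap_coord (g : L0) (s : List Bool) :
    (fun f => actMap g f s) =ᵐ[gamInf] W (circleMul g (coordL2 s)) := by
  filter_upwards [actFun_coord g, coeFn_actMap g] with f h1 h2
  rw [h2, h1, coordFun]

/-- Both sides are continuous in `h` and agree on step functions by `phi_actFun`. This is the
intertwining relation behind multiplicativity and continuity of the action. -/
lemma comp_actMap (g : L0) (h : Lp ℂ 2 lam) :
    Lp.compMeasurePreserving (actMap g) (actMap g).2 (W h) = W (circleMul g h) := by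
  have he : ((Lp.compMeasurePreservingₗᵢ ℂ (actMap g) (actMap g).2).comp W).toContinuousLinearMap =
      (W.comp (circleMul g)).toContinuousLinearMap := by
    refine eq_of_total span_stepL2 fun i => Lp.ext ?_
    change ⇑(Lp.compMeasurePreserving (actMap g) (actMap g).2 (W (stepL2 i.2))) =ᵐ[gamInf]
      W (circleMul g (stepL2 i.2))
    have h1 : W (stepL2 i.2) =ᵐ[gamInf] phi i.2 := by rw [W_stepL2]; exact coeFn_phiL2 _
    filter_upwards [Lp.coeFn_compMeasurePreserving (W (stepL2 i.2)) (actMap g).2,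
      (actMap g).2.quasiMeasurePreserving.ae_eq_comp h1, coeFn_actMap g, phi_actFun g i.2]
      with f h1 h2 h3 h4
    rw [h1, h2, Function.comp, h3, h4]
  exact congrArg (fun S : Lp ℂ 2 lam →L[ℂ] Lp ℂ 2 gamInf => S h) he

lemma MPMap.ext_coord {S T : MPMap gamInf}
    (h : ∀ s, (fun f => S f s) =ᵐ[gamInf] fun f => T f s) : S = T := by
  refine MPMap.ext ?_
  filter_upwards [ae_all_iff.2 h] with f hf
  exact Subtype.ext (funext hf)

/-- The homomorphism defined by `actMap`. -/
def actHom : L0 →* MPMap gamInf where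
  toFun := actMap
  map_one' := by
    refine MPMap.ext_coord fun s => (actMap_coord 1 s).trans ?_
    rw [circleMul_one]
    filter_upwards [W_coordL2 s, MPMap.coe_one gamInf] with f h1 h2
    rw [h1, h2, id]
  map_mul' g g' := by
    refine MPMap.ext_coord fun s => (actMap_coord _ s).trans ?_
    -- Composition with point maps reverses the order of factors; commutativity of `L0` makes the
    -- result a homomorphism.
    rw [mul_comm g g', circleMul_mul, ← comp_actMap]
    filter_upwards [Lp.coeFn_compMeasurePreserving (W (circleMul g (coordL2 s))) (actMap g').2,
      (actMap g').2.quasiMeasurePreserving.ae_eq_comp (actMap_coord g s),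
      MPMap.coe_mul (actMap g) (actMap g')] with f h1 h2 h3
    rw [h1, ← h2, h3]
    rfl

/-- The Gaussian action. -/
def gaussAction : L0 →* Aut gamInf := actHom.toHomUnits

/-- At a level beyond both `n` and the length of `s`, the action on points and the multiplication
are both diagonal and can be compared through `phi`. -/
lemma actMap_step {n : ℕ} (c : (Fin n → Bool) → Circle) : actMap (step c) =ᵐ[gamInf] stepAct c := by
  have h : ∀ s, (fun f => actMap (step c) f s) =ᵐ[gamInf] fun f => stepAct c f s := by
    intro s
    refine (actMap_coord _ s).trans ?_
    rw [coordL2, ← step_raise (le_max_left n s.length) c,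
      ← stepL2_raise (le_max_right n s.length) (coordStep s), circleMul_step, W_stepL2]
    refine (coeFn_phiL2 _).trans (ae_of_all _ fun f => ?_)
    rw [← phi_stepAct_of_le, phi_raise, phi_coordStep]
  filter_upwards [ae_all_iff.2 h] with f hf
  exact Subtype.ext (funext hf)

/-! ### Continuity of the action -/

/-- Composition of `L²` functions with `cis`. -/
def cisL2 (x : Lp ℂ 2 gamInf) : Lp ℂ 2 gamInf :=
  Lp.const 2 gamInf (1 : ℂ) + lipschitzWith_cisSub.compLp cisSub_zero x

lemma continuous_cisL2 : Continuous cisL2 :=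
  continuous_const.add (lipschitzWith_cisSub.continuous_compLp cisSub_zero)

lemma coeFn_cisL2 (x : Lp ℂ 2 gamInf) : cisL2 x =ᵐ[gamInf] fun f => cis (x f) := by
  filter_upwards [Lp.coeFn_add (Lp.const 2 gamInf (1 : ℂ))
    (lipschitzWith_cisSub.compLp cisSub_zero x), Lp.coeFn_const (p := 2) (μ := gamInf) (1 : ℂ),
    lipschitzWith_cisSub.coeFn_compLp cisSub_zero x] with f h1 h2 h3
  rw [cisL2, h1, Pi.add_apply, h2, h3]
  simp [cisSub]

lemma comp_cisL2 {T : XInf → XInf} (hT : MeasurePreserving T gamInf gamInf) (x : Lp ℂ 2 gamInf) :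
    Lp.compMeasurePreserving T hT (cisL2 x) = cisL2 (Lp.compMeasurePreserving T hT x) := by
  refine Lp.ext ?_
  filter_upwards [Lp.coeFn_compMeasurePreserving (cisL2 x) hT,
    hT.quasiMeasurePreserving.ae_eq_comp (coeFn_cisL2 x),
    coeFn_cisL2 (Lp.compMeasurePreserving T hT x), Lp.coeFn_compMeasurePreserving x hT]
    with f h1 h2 h3 h4
  rw [h1, h2, h3, h4]
  rfl

lemma phi_neg {n : ℕ} (c : (Fin n → Bool) → ℂ) (f : XInf) : phi (-c) f = - phi c f := by
  simp [phi, neg_div]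

/-- Uniqueness of characteristic functions in Hilbert space form. The characters are taken at `-c`
because the inner product conjugates its first argument. -/
lemma cisL2_total (v : Lp ℂ 2 gamInf)
    (h : ∀ i : Σ n : ℕ, (Fin n → Bool) → ℂ, ⟪cisL2 (phiL2 i.2), v⟫_ℂ = 0) : v = 0 := by
  have hv : Integrable v gamInf := (Lp.memLp v).integrable one_le_two
  refine Lp.ext ((ae_eq_zero_of_integral_cis hv fun n c => ?_).trans (Lp.coeFn_zero ℂ 2 _).symm)
  rw [← h ⟨n, -c⟩, L2.inner_def]
  refine integral_congr_ae ?_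
  filter_upwards [coeFn_cisL2 (phiL2 (-c)), coeFn_phiL2 (-c)] with f h1 h2
  rw [RCLike.inner_apply, h1, h2, phi_neg, cis_neg]
  simp

/-- On the total family of characters, composition with `actMap` passes inside `cisL2` and becomes
multiplication on `L²(λ)`, where `tendsto_circleMul` applies. -/
lemma tendsto_comp_actMap {u : ℕ → L0} {g : L0}
    (h : ∀ᵐ a ∂lam, Tendsto (fun n => u n a) atTop (𝓝 (g a))) (x : Lp ℂ 2 gamInf) :
    Tendsto (fun n => Lp.compMeasurePreserving (actMap (u n)) (actMap (u n)).2 x) atTop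
      (𝓝 (Lp.compMeasurePreserving (actMap g) (actMap g).2 x)) := by
  refine tendsto_of_total (S := fun n => Lp.compMeasurePreservingₗᵢ ℂ (actMap (u n)) (actMap (u n)).2)
    (T := Lp.compMeasurePreservingₗᵢ ℂ (actMap g) (actMap g).2) (span_closure_eq_top cisL2_total)
    (fun i => ?_) x
  change Tendsto (fun n => Lp.compMeasurePreserving (actMap (u n)) (actMap (u n)).2
    (cisL2 (phiL2 i.2))) atTop (𝓝 (Lp.compMeasurePreserving (actMap g) (actMap g).2
      (cisL2 (phiL2 i.2))))
  simp_rw [comp_cisL2, ← W_stepL2, comp_actMap]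
  exact (continuous_cisL2.tendsto _).comp ((W.continuous.tendsto _).comp (tendsto_circleMul h _))

/-- The measure of a symmetric difference is a squared `L²` distance of indicators, so strong
convergence of the composition operators implies weak convergence of the maps. -/
lemma measure_preimage_symmDiff {X : Type*} [TopologicalSpace X] [MeasurableSpace X]
    {μ : Measure X} [IsFiniteMeasure μ] (T : MPMap μ) {A B : Set X}
    (hA : MeasurableSet A) (hB : MeasurableSet B) :
    μ ((T ⁻¹' A) ∆ B) = ENNReal.ofReal (dist (Lp.compMeasurePreserving T T.2
      (indicatorConstLp 2 hA (measure_ne_top μ A) (1 : ℂ)))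
      (indicatorConstLp 2 hB (measure_ne_top μ B) 1) ^ 2) := by
  rw [Lp.indicatorConstLp_compMeasurePreserving, dist_indicatorConstLp_eq_norm,
    norm_indicatorConstLp two_ne_zero ENNReal.ofNat_ne_top]
  simp only [norm_one, one_mul, ENNReal.toReal_ofNat]
  rw [← Real.sqrt_eq_rpow, Real.sq_sqrt measureReal_nonneg, ofReal_measureReal]

section AutTopology

variable {X : Type*} [TopologicalSpace X] [TopologicalSpace.MetrizableSpace X]
  [SecondCountableTopology X] [MeasurableSpace X] [BorelSpace X] {μ : Measure X}

lemma continuous_measure_symmDiff {A B : Set X} (hA : MeasurableSet A) (hB : MeasurableSet B) :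
    Continuous fun T : Aut μ => μ (((T : MPMap μ) ⁻¹' A) ∆ B) :=
  continuous_iInf_dom (i := ⟨A, hA⟩) (continuous_iInf_dom (i := ⟨B, hB⟩) continuous_induced_dom)

/-- Taking for `B` the preimage of `A` under `T'` forces the limit of the symmetric differences to
be 0, so both preimages agree almost everywhere. Countably many sets `A` separate the points of `X`.
-/
lemma Aut.tendsto_unique {S : ℕ → Aut μ} {T T' : Aut μ} (h : Tendsto S atTop (𝓝 T))
    (h' : Tendsto S atTop (𝓝 T')) : T = T' := by
  refine Units.ext (MPMap.ext ?_)
  refine Filter.EventuallyEq.of_forall_separating_preimage MeasurableSet fun A hA => ?_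
  have hm : MeasurableSet ((T' : MPMap μ) ⁻¹' A) := (T' : MPMap μ).2.measurable hA
  have h1 := tendsto_nhds_unique
    (((continuous_measure_symmDiff hA hm).tendsto T).comp h)
    (((continuous_measure_symmDiff hA hm).tendsto T').comp h')
  rw [symmDiff_self] at h1
  exact measure_symmDiff_eq_zero_iff.1 (h1.trans measure_empty)

end AutTopology

lemma continuous_gaussAction : Continuous gaussAction := by
  refine continuous_iInf_rng.2 fun A => continuous_iInf_rng.2 fun B => continuous_induced_rng.2 ?_
  refine continuous_L0_of_ae fun u g h => ?_
  have he : ∀ g : L0, ((fun T : Aut gamInf => gamInf (((T : MPMap gamInf) ⁻¹' A.1) ∆ B.1)) ∘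
      gaussAction) g = gamInf ((actMap g ⁻¹' A.1) ∆ B.1) := fun g => rfl
  simp_rw [he, measure_preimage_symmDiff _ A.2 B.2]
  exact (ENNReal.continuous_ofReal.tendsto _).comp
    (((tendsto_comp_actMap h _).dist tendsto_const_nhds).pow 2)

lemma isGaussianAction_gaussAction : IsGaussianAction gaussAction :=
  ⟨continuous_gaussAction, fun _ c => actMap_step c⟩

/-- The two actions agree on step functions, which approximate every `g`, and limits in `Aut` are
unique. -/
lemma IsGaussianAction.unique {Θ Θ' : L0 →* Aut gamInf} (h : IsGaussianAction Θ)
    (h' : IsGaussianAction Θ') : Θ = Θ' := by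
  ext1 g
  obtain ⟨n, c, hc⟩ := exists_seq_step_tendsto g
  have hlim := tendsto_L0_of_ae hc
  have he : ∀ k, Θ (step (c k)) = Θ' (step (c k)) := fun k =>
    Units.ext (MPMap.ext ((h.2 _ (c k)).trans (h'.2 _ (c k)).symm))
  refine Aut.tendsto_unique ((h.1.tendsto g).comp hlim) ?_
  refine ((h'.1.tendsto g).comp hlim).congr fun k => (he k).symm

/-! ### Exponential vectors in the Gaussian space -/

/-- The exponential vector of a pair of step functions. -/
def expFun {n : ℕ} (h k : (Fin n → Bool) → ℂ) (f : XInf) : ℂ :=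
  Complex.exp (-⟪stepL2 k, stepL2 h⟫_ℂ) * Complex.exp (phi h f + starRingEnd ℂ (phi k f))

lemma phi_add {n : ℕ} (c d : (Fin n → Bool) → ℂ) (f : XInf) : phi (c + d) f = phi c f + phi d f := by
  simp only [phi, Pi.add_apply, add_mul, Finset.sum_add_distrib, add_div]

lemma measurable_expFun {n : ℕ} (h k : (Fin n → Bool) → ℂ) : Measurable (expFun h k) :=
  (Complex.continuous_exp.measurable.comp ((measurable_phi h).add
    (Complex.continuous_conj.measurable.comp (measurable_phi k)))).const_mul _

lemma conj_expFun_mul {n : ℕ} (h k h' k' : (Fin n → Bool) → ℂ) (f : XInf) :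
    starRingEnd ℂ (expFun h k f) * expFun h' k' f =
      Complex.exp (-⟪stepL2 h, stepL2 k⟫_ℂ - ⟪stepL2 k', stepL2 h'⟫_ℂ) *
        Complex.exp (phi (k + h') f + starRingEnd ℂ (phi (h + k') f)) := by
  simp only [expFun, ← Complex.exp_conj, map_add, map_neg, Complex.conj_conj, phi_add,
    inner_conj_symm, ← Complex.exp_add]
  congr 1
  ring

lemma memLp_expFun {n : ℕ} (h k : (Fin n → Bool) → ℂ) : MemLp (expFun h k) 2 gamInf := by
  rw [memLp_two_iff_integrable_sq_norm (measurable_expFun h k).aestronglyMeasurable]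
  have h1 : Integrable (fun f => starRingEnd ℂ (expFun h k f) * expFun h k f) gamInf := by
    simp_rw [conj_expFun_mul]
    exact (integrable_exp_phi _ _).const_mul _
  refine h1.norm.congr (ae_of_all _ fun f => ?_)
  simp only [norm_mul, RCLike.norm_conj]
  ring

/-- The class in `L²` of an exponential vector. -/
def expL2 {n : ℕ} (h k : (Fin n → Bool) → ℂ) : Lp ℂ 2 gamInf := (memLp_expFun h k).toLp _

lemma coeFn_expL2 {n : ℕ} (h k : (Fin n → Bool) → ℂ) : expL2 h k =ᵐ[gamInf] expFun h k :=
  (memLp_expFun h k).coeFn_toLp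

/-- Of the four terms of `⟪h + k', k + h'⟫`, the normalizing factors of the two vectors cancel `⟪h,
k⟫` and `⟪k', h'⟫`. -/
lemma inner_expL2 {n : ℕ} (h k h' k' : (Fin n → Bool) → ℂ) :
    ⟪expL2 h k, expL2 h' k'⟫_ℂ =
      Complex.exp (⟪stepL2 h, stepL2 h'⟫_ℂ + ⟪stepL2 k', stepL2 k⟫_ℂ) := by
  have h1 : ⟪expL2 h k, expL2 h' k'⟫_ℂ =
      ∫ f, starRingEnd ℂ (expFun h k f) * expFun h' k' f ∂gamInf := by
    rw [L2.inner_def]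
    refine integral_congr_ae ?_
    filter_upwards [coeFn_expL2 h k, coeFn_expL2 h' k'] with f h1 h2
    rw [h1, h2, RCLike.inner_apply, mul_comm]
  rw [h1]
  simp_rw [conj_expFun_mul]
  rw [integral_const_mul, integral_exp_phi, ← Complex.exp_add, stepL2_add, stepL2_add,
    inner_add_left, inner_add_right, inner_add_right]
  congr 1
  ring

lemma expFun_zero (n : ℕ) (f : XInf) : expFun (0 : (Fin n → Bool) → ℂ) 0 f = 1 := by
  have h0 : stepL2 (0 : (Fin n → Bool) → ℂ) = 0 := rfl
  simp [expFun, phi, h0]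

lemma expL2_zero (n : ℕ) : expL2 (0 : (Fin n → Bool) → ℂ) 0 = Lp.const 2 gamInf (1 : ℂ) := by
  refine Lp.ext ((coeFn_expL2 _ _).trans ?_)
  filter_upwards [Lp.coeFn_const (p := 2) (μ := gamInf) (1 : ℂ)] with f h1
  rw [h1, expFun_zero]
  rfl

lemma expL2_raise {n N : ℕ} (hn : n ≤ N) (h k : (Fin n → Bool) → ℂ) :
    expL2 (raise hn h) (raise hn k) = expL2 h k := by
  unfold expL2
  congr 1
  funext f
  simp only [expFun, phi_raise, stepL2_raise]

/-- The exponential vector with the constant 1 subtracted. -/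
def expSub {n : ℕ} (h k : (Fin n → Bool) → ℂ) : Lp ℂ 2 gamInf :=
  expL2 h k - Lp.const 2 gamInf (1 : ℂ)

lemma expSub_raise {n N : ℕ} (hn : n ≤ N) (h k : (Fin n → Bool) → ℂ) :
    expSub (raise hn h) (raise hn k) = expSub h k := by
  rw [expSub, expL2_raise, expSub]

lemma inner_expSub {n : ℕ} (h k h' k' : (Fin n → Bool) → ℂ) :
    ⟪expSub h k, expSub h' k'⟫_ℂ =
      Complex.exp (⟪stepL2 h, stepL2 h'⟫_ℂ + ⟪stepL2 k', stepL2 k⟫_ℂ) - 1 := by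
  have h0 : stepL2 (0 : (Fin n → Bool) → ℂ) = 0 := rfl
  rw [expSub, expSub, ← expL2_zero n, inner_sub_left, inner_sub_right, inner_sub_right]
  simp only [inner_expL2]
  simp [h0]

lemma const_eq_smul (c : ℂ) : Lp.const 2 gamInf c = c • Lp.const 2 gamInf (1 : ℂ) := by
  have := (Lp.constₗ 2 gamInf ℂ : ℂ →ₗ[ℂ] Lp ℂ 2 gamInf).map_smul c 1
  simpa using this

lemma expSub_mem {n : ℕ} (h k : (Fin n → Bool) → ℂ) : expSub h k ∈ (constants gamInf)ᗮ := by
  rw [Submodule.mem_orthogonal]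
  rintro _ ⟨c, rfl⟩
  have h0 : stepL2 (0 : (Fin n → Bool) → ℂ) = 0 := rfl
  change ⟪Lp.const 2 gamInf c, expSub h k⟫_ℂ = 0
  rw [const_eq_smul, expSub, ← expL2_zero n, inner_smul_left, inner_sub_right, inner_expL2,
    inner_expL2]
  simp [h0]

/-- The exponential vector as an element of the orthogonal complement of the constants. -/
def expVec (i : Σ n : ℕ, ((Fin n → Bool) → ℂ) × ((Fin n → Bool) → ℂ)) :
    ((constants gamInf)ᗮ : Submodule ℂ (Lp ℂ 2 gamInf)) :=
  ⟨expSub i.2.1 i.2.2, expSub_mem _ _⟩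

/-- The character `cis (phi c)` is a nonzero multiple of the exponential vector of `((i/2) c, -(i/2)
c)`, and orthogonality to the constants makes the subtracted 1 harmless. -/
lemma expVec_total (v : ((constants gamInf)ᗮ : Submodule ℂ (Lp ℂ 2 gamInf)))
    (h : ∀ i, ⟪expVec i, v⟫_ℂ = 0) : v = 0 := by
  have h1 : ⟪Lp.const 2 gamInf (1 : ℂ), (v : Lp ℂ 2 gamInf)⟫_ℂ = 0 :=
    (Submodule.mem_orthogonal _ _).1 v.2 _ ⟨1, rfl⟩
  refine Subtype.ext (cisL2_total _ fun i => ?_)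
  have h2 := h ⟨i.1, (Complex.I / 2) • i.2, (-(Complex.I / 2)) • i.2⟩
  rw [Submodule.coe_inner, expVec] at h2
  simp only [expSub] at h2
  rw [inner_sub_left, h1, sub_zero] at h2
  set a := Complex.exp (-⟪stepL2 ((-(Complex.I / 2)) • i.2), stepL2 ((Complex.I / 2) • i.2)⟫_ℂ)
    with ha
  have h3 : expL2 ((Complex.I / 2) • i.2) ((-(Complex.I / 2)) • i.2) = a • cisL2 (phiL2 i.2) := by
    refine Lp.ext ((coeFn_expL2 _ _).trans ?_)
    filter_upwards [Lp.coeFn_smul a (cisL2 (phiL2 i.2)), coeFn_cisL2 (phiL2 i.2),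
      coeFn_phiL2 i.2] with f h4 h5 h6
    rw [h4, Pi.smul_apply, h5, h6, expFun, cis_phi, smul_eq_mul]
  rw [h3, inner_smul_left, mul_eq_zero] at h2
  refine h2.resolve_left ?_
  simp [ha]

/-! ### The Koopman representation on exponential vectors -/

lemma koopman_gaussAction (g : L0) (x : Lp ℂ 2 gamInf) :
    koopman gamInf (gaussAction g) x =
      Lp.compMeasurePreserving (actMap g⁻¹) (actMap g⁻¹).2 x := rfl

lemma step_inv {n : ℕ} (c : (Fin n → Bool) → Circle) : (step c)⁻¹ = step c⁻¹ := rfl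

lemma inner_circle_mul {n : ℕ} (c : (Fin n → Bool) → Circle) (h k : (Fin n → Bool) → ℂ) :
    ⟪stepL2 fun t => (c t : ℂ) * h t, stepL2 fun t => (c t : ℂ) * k t⟫_ℂ =
      ⟪stepL2 h, stepL2 k⟫_ℂ := by
  rw [← circleMul_step, ← circleMul_step, LinearIsometry.inner_map_map]

/-- The inverse comes from `f ∘ Θ(g)⁻¹`; by duality it multiplies both arguments, and the
normalizing factor is unchanged since multiplication by a unimodular function is unitary. -/
lemma koopman_step_expL2 {n : ℕ} (c : (Fin n → Bool) → Circle) (h k : (Fin n → Bool) → ℂ) :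
    koopman gamInf (gaussAction (step c)) (expL2 h k) =
      expL2 (fun t => ((c⁻¹ t : Circle) : ℂ) * h t) fun t => ((c⁻¹ t : Circle) : ℂ) * k t := by
  rw [koopman_gaussAction, step_inv]
  refine Lp.ext ?_
  have hphi : ∀ (d : (Fin n → Bool) → ℂ) f, phi d (stepAct c⁻¹ f) =
      phi (fun t => ((c⁻¹ t : Circle) : ℂ) * d t) f := fun d f => phi_stepAct_of_le le_rfl c⁻¹ d f
  filter_upwards [Lp.coeFn_compMeasurePreserving (expL2 h k) (actMap (step c⁻¹)).2,
    (actMap (step c⁻¹)).2.quasiMeasurePreserving.ae_eq_comp (coeFn_expL2 h k),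
    actMap_step c⁻¹, coeFn_expL2 (fun t => ((c⁻¹ t : Circle) : ℂ) * h t)
      fun t => ((c⁻¹ t : Circle) : ℂ) * k t] with f h1 h2 h3 h4
  rw [h1, h2, h4, Function.comp, h3]
  simp only [expFun, hphi, inner_circle_mul]

lemma koopmanZero_step_expVec {n : ℕ} (c : (Fin n → Bool) → Circle) (h k : (Fin n → Bool) → ℂ) :
    koopmanZero gaussAction (step c) (expVec ⟨n, h, k⟩) =
      expVec ⟨n, fun t => ((c⁻¹ t : Circle) : ℂ) * h t, fun t => ((c⁻¹ t : Circle) : ℂ) * k t⟩ := by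
  refine Subtype.ext ?_
  change koopman gamInf (gaussAction (step c)) (expSub h k) = expSub _ _
  rw [expSub, map_sub, koopman_step_expL2, koopman_const]
  rfl

lemma expVec_raise {n N : ℕ} (hn : n ≤ N) (h k : (Fin n → Bool) → ℂ) :
    expVec ⟨N, raise hn h, raise hn k⟩ = expVec ⟨n, h, k⟩ :=
  Subtype.ext (expSub_raise hn h k)

lemma tendsto_koopmanZero {u : ℕ → L0} {g : L0}
    (h : ∀ᵐ a ∂lam, Tendsto (fun n => u n a) atTop (𝓝 (g a)))
    (x : ((constants gamInf)ᗮ : Submodule ℂ (Lp ℂ 2 gamInf))) :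
    Tendsto (fun n => koopmanZero gaussAction (u n) x) atTop
      (𝓝 (koopmanZero gaussAction g x)) := by
  refine tendsto_subtype_rng.2 ?_
  have h' : ∀ᵐ a ∂lam, Tendsto (fun n => (u n)⁻¹ a) atTop (𝓝 (g⁻¹ a)) := by
    filter_upwards [h, AEEqFun.coeFn_inv g, ae_all_iff.2 fun n => AEEqFun.coeFn_inv (u n)]
      with a h1 h2 h3
    simp_rw [h2, h3]
    exact h1.inv
  exact tendsto_comp_actMap h' x.1

/-! ### Product functions -/

/-- The tensor product of step functions. -/
def tensFun {p q n : ℕ} (x : Fin p → (Fin n → Bool) → ℂ) (y : Fin q → (Fin n → Bool) → ℂ)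
    (z : CSpace p q) : ℂ :=
  (∏ i, stepFun (x i) (z.1 i)) * ∏ j, stepFun (y j) (z.2 j)

lemma measurable_tensFun {p q n : ℕ} (x : Fin p → (Fin n → Bool) → ℂ)
    (y : Fin q → (Fin n → Bool) → ℂ) : Measurable (tensFun x y) := by
  refine Measurable.mul ?_ ?_
  · exact Finset.measurable_fun_prod _ fun i _ =>
      (measurable_stepFun _).comp ((measurable_pi_apply i).comp measurable_fst)
  · exact Finset.measurable_fun_prod _ fun j _ =>
      (measurable_stepFun _).comp ((measurable_pi_apply j).comp measurable_snd)

lemma memLp_tensFun {p q n : ℕ} (x : Fin p → (Fin n → Bool) → ℂ)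
    (y : Fin q → (Fin n → Bool) → ℂ) : MemLp (tensFun x y) 2 (muPQ p q) := by
  refine MemLp.of_bound (measurable_tensFun x y).aestronglyMeasurable
    ((∏ i, ∑ t, ‖x i t‖) * ∏ j, ∑ t, ‖y j t‖) (ae_of_all _ fun z => ?_)
  rw [tensFun, norm_mul, norm_prod, norm_prod]
  gcongr with i _ j _
  · exact norm_stepFun_le _ _
  · exact norm_stepFun_le _ _

/-- The class in `L²` of a tensor product of step functions. -/
def tensL2 {p q n : ℕ} (x : Fin p → (Fin n → Bool) → ℂ) (y : Fin q → (Fin n → Bool) → ℂ) :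
    Lp ℂ 2 (muPQ p q) := (memLp_tensFun x y).toLp _

lemma coeFn_tensL2 {p q n : ℕ} (x : Fin p → (Fin n → Bool) → ℂ) (y : Fin q → (Fin n → Bool) → ℂ) :
    tensL2 x y =ᵐ[muPQ p q] tensFun x y := (memLp_tensFun x y).coeFn_toLp

lemma integral_tensFun {p q n : ℕ} (c d : (Fin n → Bool) → ℂ) :
    ∫ z, tensFun (fun _ : Fin p => c) (fun _ : Fin q => d) z ∂muPQ p q =
      (∫ a, stepFun c a ∂lam) ^ p * (∫ a, stepFun d a ∂lam) ^ q := by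
  unfold tensFun muPQ
  rw [integral_prod_mul (fun a : Fin p → Cantor => ∏ i, stepFun c (a i))
    (fun b : Fin q → Cantor => ∏ j, stepFun d (b j)),
    integral_fintype_prod_eq_pow (stepFun c),
    integral_fintype_prod_eq_pow (stepFun d)]
  simp

lemma inner_tensL2 {p q n : ℕ} (c d c' d' : (Fin n → Bool) → ℂ) :
    ⟪tensL2 (fun _ : Fin p => c) (fun _ : Fin q => d), tensL2 (fun _ => c') fun _ => d'⟫_ℂ =
      ⟪stepL2 c, stepL2 c'⟫_ℂ ^ p * ⟪stepL2 d, stepL2 d'⟫_ℂ ^ q := by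
  have h1 : ∀ c d : (Fin n → Bool) → ℂ, ⟪stepL2 c, stepL2 d⟫_ℂ =
      ∫ a, stepFun (fun t => starRingEnd ℂ (c t) * d t) a ∂lam := by
    intro c d
    rw [inner_stepL2, integral_stepFun]
  rw [h1, h1, ← integral_tensFun, L2.inner_def]
  refine integral_congr_ae ?_
  filter_upwards [coeFn_tensL2 (fun _ : Fin p => c) (fun _ : Fin q => d),
    coeFn_tensL2 (fun _ : Fin p => c') (fun _ : Fin q => d')] with z h2 h3
  rw [h2, h3, RCLike.inner_apply, mul_comm]
  simp only [tensFun, map_mul, map_prod, stepFun, Finset.prod_mul_distrib]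
  ring

/-! ### Symmetric functions -/

lemma tensFun_perm {p q n : ℕ} (x : Fin p → (Fin n → Bool) → ℂ) (y : Fin q → (Fin n → Bool) → ℂ)
    (σ : Equiv.Perm (Fin p)) (τ : Equiv.Perm (Fin q)) (z : CSpace p q) :
    tensFun (x ∘ σ) (y ∘ τ) z = tensFun x y (z.1 ∘ ⇑σ⁻¹, z.2 ∘ ⇑τ⁻¹) := by
  unfold tensFun
  congr 1
  · rw [← Equiv.prod_comp σ fun i => stepFun (x i) ((z.1 ∘ ⇑σ⁻¹) i)]
    simp
  · rw [← Equiv.prod_comp τ fun i => stepFun (y i) ((z.2 ∘ ⇑τ⁻¹) i)]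
    simp

lemma tensL2_perm {p q n : ℕ} (x : Fin p → (Fin n → Bool) → ℂ) (y : Fin q → (Fin n → Bool) → ℂ)
    (σ : Equiv.Perm (Fin p)) (τ : Equiv.Perm (Fin q)) :
    tensL2 (x ∘ σ) (y ∘ τ) = Lp.compMeasurePreserving _ (mp_perm p q σ⁻¹ τ⁻¹) (tensL2 x y) := by
  refine Lp.ext ((coeFn_tensL2 _ _).trans ?_)
  filter_upwards [Lp.coeFn_compMeasurePreserving (tensL2 x y) (mp_perm p q σ⁻¹ τ⁻¹),
    (mp_perm p q σ⁻¹ τ⁻¹).quasiMeasurePreserving.ae_eq_comp (coeFn_tensL2 x y)] with z h1 h2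
  rw [h1, h2, tensFun_perm]
  rfl

lemma tensL2_const_mem_symL2 {p q n : ℕ} (c d : (Fin n → Bool) → ℂ) :
    tensL2 (fun _ : Fin p => c) (fun _ : Fin q => d) ∈ symL2 p q := by
  intro σ τ
  have h := tensL2_perm (fun _ : Fin p => c) (fun _ : Fin q => d) σ⁻¹ τ⁻¹
  simp only [inv_inv] at h
  exact h.symm

lemma inner_tensL2_perm {p q n : ℕ} (x : Fin p → (Fin n → Bool) → ℂ)
    (y : Fin q → (Fin n → Bool) → ℂ) (σ : Equiv.Perm (Fin p)) (τ : Equiv.Perm (Fin q))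
    {v : Lp ℂ 2 (muPQ p q)} (hv : v ∈ symL2 p q) :
    ⟪tensL2 (x ∘ σ) (y ∘ τ), v⟫_ℂ = ⟪tensL2 x y, v⟫_ℂ := by
  rw [tensL2_perm]
  nth_rewrite 1 [← hv σ⁻¹ τ⁻¹]
  exact (Lp.compMeasurePreservingₗᵢ (E := ℂ) (p := 2) ℂ _
    (mp_perm p q σ⁻¹ τ⁻¹)).inner_map_map (tensL2 x y) v

/-- Polarization applied pointwise to the first `p` and to the last `q` variables. -/
lemma sum_tensL2_eq {p q n : ℕ} (x : Fin p → (Fin n → Bool) → ℂ) (y : Fin q → (Fin n → Bool) → ℂ) :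
    ∑ S : Finset (Fin p) × Finset (Fin q),
      ((-1 : ℂ) ^ (p - S.1.card) * (-1 : ℂ) ^ (q - S.2.card)) •
        tensL2 (fun _ : Fin p => ∑ i ∈ S.1, x i) (fun _ : Fin q => ∑ j ∈ S.2, y j) =
      ∑ σ : Equiv.Perm (Fin p) × Equiv.Perm (Fin q), (1 : ℂ) • tensL2 (x ∘ σ.1) (y ∘ σ.2) := by
  refine Lp.ext ?_
  filter_upwards [coeFn_sum_smul (fun S : Finset (Fin p) × Finset (Fin q) =>
      (-1 : ℂ) ^ (p - S.1.card) * (-1 : ℂ) ^ (q - S.2.card))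
      fun S => tensL2 (fun _ : Fin p => ∑ i ∈ S.1, x i) (fun _ : Fin q => ∑ j ∈ S.2, y j),
    coeFn_sum_smul (fun _ : Equiv.Perm (Fin p) × Equiv.Perm (Fin q) => (1 : ℂ))
      fun σ => tensL2 (x ∘ σ.1) (y ∘ σ.2),
    ae_all_iff.2 fun S : Finset (Fin p) × Finset (Fin q) =>
      coeFn_tensL2 (fun _ : Fin p => ∑ i ∈ S.1, x i) (fun _ : Fin q => ∑ j ∈ S.2, y j),
    ae_all_iff.2 fun σ : Equiv.Perm (Fin p) × Equiv.Perm (Fin q) =>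
      coeFn_tensL2 (x ∘ σ.1) (y ∘ σ.2)] with z h1 h2 h3 h4
  rw [h1, h2]
  simp only [h3, h4, tensFun, one_mul]
  have hs : ∀ {m : ℕ} (S : Finset (Fin m)) (w : Fin m → (Fin n → Bool) → ℂ) (a : Cantor),
      stepFun (∑ i ∈ S, w i) a = ∑ i ∈ S, stepFun (w i) a := by
    intro m S w a
    simp [stepFun, Finset.sum_apply]
  simp only [hs]
  rw [Fintype.sum_prod_type, Fintype.sum_prod_type]
  have e1 := sum_powerset_prod_sum fun j i => stepFun (x j) (z.1 i)
  have e2 := sum_powerset_prod_sum fun j i => stepFun (y j) (z.2 i)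
  simp only [Function.comp_apply]
  simp_rw [← Finset.mul_sum, ← Finset.sum_mul]
  rw [← e1, ← e2, Finset.sum_mul]
  refine Finset.sum_congr rfl fun S _ => ?_
  rw [Finset.mul_sum]
  exact Finset.sum_congr rfl fun S' _ => by ring

/-- By polarization the symmetrization of a tensor is a combination of diagonal ones. Pairing with a
symmetric `v` gives the same value for every rearrangement, so `p! q!` times the inner product is 0.
-/
lemma inner_tensL2_eq_zero {p q : ℕ} {v : Lp ℂ 2 (muPQ p q)} (hv : v ∈ symL2 p q)
    (h : ∀ (n : ℕ) (c d : (Fin n → Bool) → ℂ), ⟪tensL2 (fun _ : Fin p => c) fun _ => d, v⟫_ℂ = 0)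
    {n : ℕ} (x : Fin p → (Fin n → Bool) → ℂ) (y : Fin q → (Fin n → Bool) → ℂ) :
    ⟪tensL2 x y, v⟫_ℂ = 0 := by
  have h1 := congrArg (fun w => ⟪w, v⟫_ℂ) (sum_tensL2_eq x y)
  simp only [sum_inner, inner_smul_left, h, mul_zero, Finset.sum_const_zero,
    inner_tensL2_perm x y _ _ hv, map_one, one_mul, Finset.sum_const, Finset.card_univ,
    nsmul_eq_mul] at h1
  exact (mul_eq_zero.1 h1.symm).resolve_left (Nat.cast_ne_zero.2 Fintype.card_ne_zero)

lemma exists_common_level {m : ℕ} {A : Fin m → Set Cantor} (hA : ∀ i, A i ∈ digitSets) :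
    ∃ n₀, ∀ n, n₀ ≤ n → ∃ B : Fin m → Set (Fin n → Bool), ∀ i, digits n ⁻¹' B i = A i := by
  choose l B hB using hA
  refine ⟨Finset.univ.sup l, fun n hn => ?_⟩
  choose B' hB' using fun i => exists_digitSet_of_le
    ((Finset.le_sup (Finset.mem_univ i)).trans hn) (B i)
  exact ⟨B', fun i => (hB' i).trans (hB i)⟩

lemma isCountablySpanning_digitSets : IsCountablySpanning digitSets :=
  ⟨fun _ => Set.univ, fun _ => univ_mem_digitSets, Set.iUnion_const _⟩

/-- Tensors of indicators are indicators of boxes of digit sets, and these form a generating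
π-system of the product. Finitely many digit sets can be written at a common level. -/
lemma eq_zero_of_inner_tensL2 {p q : ℕ} {v : Lp ℂ 2 (muPQ p q)}
    (h : ∀ (n : ℕ) (x : Fin p → (Fin n → Bool) → ℂ) (y : Fin q → (Fin n → Bool) → ℂ),
      ⟪tensL2 x y, v⟫_ℂ = 0) : v = 0 := by
  classical
  have hv : Integrable v (muPQ p q) := (Lp.memLp v).integrable one_le_two
  have hgen : ∀ m : ℕ, (inferInstance : MeasurableSpace (Fin m → Cantor)) =
      MeasurableSpace.generateFrom (Set.univ.pi '' Set.univ.pi fun _ => digitSets) := fun m =>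
    (generateFrom_eq_pi (fun _ => generateFrom_digitSets.symm)
      fun _ => isCountablySpanning_digitSets).symm
  have hsp : ∀ m : ℕ, IsCountablySpanning
      (Set.univ.pi '' Set.univ.pi fun _ : Fin m => digitSets) := fun m =>
    IsCountablySpanning.pi fun _ => isCountablySpanning_digitSets
  have hpi : ∀ m : ℕ, IsPiSystem (Set.univ.pi '' Set.univ.pi fun _ : Fin m => digitSets) :=
    fun m => IsPiSystem.pi fun _ => isPiSystem_digitSets
  have hbox : ∀ S ∈ Set.image2 (· ×ˢ ·) (Set.univ.pi '' Set.univ.pi fun _ : Fin p => digitSets)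
      (Set.univ.pi '' Set.univ.pi fun _ : Fin q => digitSets), ∫ z in S, v z ∂muPQ p q = 0 := by
    rintro _ ⟨_, ⟨A, hA, rfl⟩, _, ⟨B, hB, rfl⟩, rfl⟩
    obtain ⟨n₁, h₁⟩ := exists_common_level fun i => hA i (Set.mem_univ i)
    obtain ⟨n₂, h₂⟩ := exists_common_level fun i => hB i (Set.mem_univ i)
    obtain ⟨A', hA'⟩ := h₁ (max n₁ n₂) (le_max_left _ _)
    obtain ⟨B', hB'⟩ := h₂ (max n₁ n₂) (le_max_right _ _)
    obtain rfl : (fun i => digits _ ⁻¹' A' i) = A := funext hA'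
    obtain rfl : (fun i => digits _ ⁻¹' B' i) = B := funext hB'
    rw [← h _ (fun i => (A' i).indicator 1) (fun i => (B' i).indicator 1), L2.inner_def,
      ← integral_indicator ((MeasurableSet.univ_pi fun i => measurable_digits _
        (A' i).toFinite.measurableSet).prod (MeasurableSet.univ_pi fun i => measurable_digits _
        (B' i).toFinite.measurableSet))]
    refine integral_congr_ae ?_
    filter_upwards [coeFn_tensL2 (fun i => (A' i).indicator (1 : (Fin (max n₁ n₂) → Bool) → ℂ))
      (fun i => (B' i).indicator 1)] with z hz
    rw [hz, RCLike.inner_apply]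
    simp only [tensFun, stepFun, Set.indicator_apply, Pi.one_apply, Finset.prod_ite_zero,
      Finset.prod_const_one, Finset.mem_univ, forall_true_left, Set.mem_prod, Set.mem_univ_pi,
      Set.mem_preimage]
    by_cases h1 : ∀ i, digits (max n₁ n₂) (z.1 i) ∈ A' i <;>
      by_cases h2 : ∀ i, digits (max n₁ n₂) (z.2 i) ∈ B' i <;> simp [h1, h2]
  refine Lp.ext ((ae_eq_zero_of_setIntegral_piSystem hv
    (generateFrom_eq_prod (hgen p).symm (hgen q).symm (hsp p) (hsp q)).symm
    ((hpi p).prod (hpi q)) ?_ hbox).trans (Lp.coeFn_zero ℂ 2 _).symm)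
  have hu := hbox _ ⟨_, ⟨fun _ => Set.univ, fun _ _ => univ_mem_digitSets, rfl⟩, _,
    ⟨fun _ => Set.univ, fun _ _ => univ_mem_digitSets, rfl⟩, rfl⟩
  simpa using hu

instance (p q : ℕ) : CompleteSpace (symL2 p q) := by
  have : IsClosed (symL2 p q : Set (Lp ℂ 2 (muPQ p q))) := by
    have h : (symL2 p q : Set (Lp ℂ 2 (muPQ p q))) =
        ⋂ σ, ⋂ τ, {f | Lp.compMeasurePreserving _ (mp_perm p q σ τ) f = f} := by
      ext f
      simp only [Set.mem_iInter]
      rfl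
    rw [h]
    exact isClosed_iInter fun σ => isClosed_iInter fun τ => isClosed_eq
      (Lp.compMeasurePreservingₗᵢ ℂ _ (mp_perm p q σ τ)).continuous continuous_id
  exact this.completeSpace_coe

/-! ### Exponential vectors in the sum of the spaces of symmetric functions -/

lemma symL2_inner_smul_left {p q : ℕ} (r : ℂ) (x y : symL2 p q) :
    ⟪r • x, y⟫_ℂ = starRingEnd ℂ r * ⟪x, y⟫_ℂ := inner_smul_left x y r

lemma symL2_inner_smul_right {p q : ℕ} (r : ℂ) (x y : symL2 p q) :
    ⟪x, r • y⟫_ℂ = r * ⟪x, y⟫_ℂ := inner_smul_right x y r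

lemma symL2_inner_self {p q : ℕ} (x : symL2 p q) : ⟪x, x⟫_ℂ = (‖x‖ : ℂ) ^ 2 :=
  inner_self_eq_norm_sq_to_K x

/-- The `ℓ²`-sum of the spaces of symmetric functions of positive degree. -/
abbrev Fock : Type := lp (fun i : {i : ℕ × ℕ // 0 < i.1 + i.2} => symL2 i.1.1 i.1.2) 2

/-- The tensor power of degree `(p, q)` of a pair of step functions. -/
def symTens (p q : ℕ) {n : ℕ} (h k : (Fin n → Bool) → ℂ) : symL2 p q :=
  ⟨tensL2 (fun _ => star k) (fun _ => h), tensL2_const_mem_symL2 _ _⟩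

/-- The component of degree `(p, q)` of an exponential vector. -/
def fockComp (p q : ℕ) {n : ℕ} (h k : (Fin n → Bool) → ℂ) : symL2 p q :=
  (((Real.sqrt (p.factorial * q.factorial))⁻¹ : ℝ) : ℂ) • symTens p q h k

lemma inner_star_stepL2 {n : ℕ} (k k' : (Fin n → Bool) → ℂ) :
    ⟪stepL2 (star k), stepL2 (star k')⟫_ℂ = ⟪stepL2 k', stepL2 k⟫_ℂ := by
  rw [inner_stepL2, inner_stepL2]
  congr 1
  refine Finset.sum_congr rfl fun t _ => ?_
  simp [mul_comm]

/-- The conjugate of `k` in the first `p` variables turns `⟪k, k'⟫` into `⟪k', k⟫`, and the factor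
`1/√(p! q!)` makes this the general term of a product of two exponential series. -/
lemma inner_fockComp (p q : ℕ) {n : ℕ} (h k h' k' : (Fin n → Bool) → ℂ) :
    ⟪fockComp p q h k, fockComp p q h' k'⟫_ℂ =
      (⟪stepL2 k', stepL2 k⟫_ℂ ^ p / p.factorial) * (⟪stepL2 h, stepL2 h'⟫_ℂ ^ q / q.factorial) := by
  rw [fockComp, fockComp, symL2_inner_smul_left, symL2_inner_smul_right, Submodule.coe_inner,
    symTens, symTens, inner_tensL2, inner_star_stepL2, Complex.conj_ofReal, ← mul_assoc,
    ← Complex.ofReal_mul, ← mul_inv,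
    Real.mul_self_sqrt (by positivity)]
  push_cast
  rw [mul_inv]
  ring

lemma hasSum_mul_of_summable_norm {f g : ℕ → ℂ} {s t : ℂ} (hf : HasSum f s) (hg : HasSum g t)
    (hf' : Summable fun n => ‖f n‖) (hg' : Summable fun n => ‖g n‖) :
    HasSum (fun i : ℕ × ℕ => f i.1 * g i.2) (s * t) :=
  hf.mul hg (summable_mul_of_summable_norm hf' hg')

lemma hasSum_pos_degree {f : ℕ × ℕ → ℂ} (h0 : f (0, 0) = 1) {s : ℂ} (h : HasSum f s) :
    HasSum (fun i : {i : ℕ × ℕ // 0 < i.1 + i.2} => f i) (s - 1) := by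
  have h2 := h.sub (hasSum_ite_eq ((0, 0) : ℕ × ℕ) (1 : ℂ))
  have h3 : ∀ i, f i - (if i = (0, 0) then 1 else 0) =
      Set.indicator {i : ℕ × ℕ | 0 < i.1 + i.2} f i := by
    intro i
    by_cases hi : i = (0, 0)
    · subst hi
      simp [h0]
    · have : 0 < i.1 + i.2 := by
        by_contra! h
        exact hi (Prod.ext (by lia) (by lia))
      rw [Set.indicator_of_mem (by exact this), if_neg hi, sub_zero]
  simp_rw [h3] at h2
  exact (hasSum_subtype_iff_indicator (s := {i : ℕ × ℕ | 0 < i.1 + i.2})).2 h2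

lemma hasSum_exp_two (a b : ℂ) :
    HasSum (fun i : {i : ℕ × ℕ // 0 < i.1 + i.2} =>
      (b ^ i.1.1 / (i.1.1.factorial : ℂ)) * (a ^ i.1.2 / (i.1.2.factorial : ℂ)))
      (Complex.exp (a + b) - 1) := by
  have hn : ∀ z : ℂ, Summable fun n : ℕ => ‖z ^ n / (n.factorial : ℂ)‖ :=
    fun z => NormedSpace.norm_expSeries_div_summable z
  have he : ∀ z : ℂ, HasSum (fun n : ℕ => z ^ n / (n.factorial : ℂ)) (Complex.exp z) := fun z => by
    rw [Complex.exp_eq_exp_ℂ]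
    exact NormedSpace.expSeries_div_hasSum_exp z
  have h1 := hasSum_mul_of_summable_norm (he b) (he a) (hn b) (hn a)
  rw [add_comm, Complex.exp_add]
  exact hasSum_pos_degree (by simp) h1

lemma memℓp_fockComp {n : ℕ} (h k : (Fin n → Bool) → ℂ) :
    Memℓp (fun i : {i : ℕ × ℕ // 0 < i.1 + i.2} => fockComp i.1.1 i.1.2 h k) 2 := by
  refine memℓp_gen ?_
  have h1 := (hasSum_exp_two ⟪stepL2 h, stepL2 h⟫_ℂ ⟪stepL2 k, stepL2 k⟫_ℂ).summable
  have h2 : ∀ i : {i : ℕ × ℕ // 0 < i.1 + i.2},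
      (⟪stepL2 k, stepL2 k⟫_ℂ ^ i.1.1 / (i.1.1.factorial : ℂ)) *
        (⟪stepL2 h, stepL2 h⟫_ℂ ^ i.1.2 / (i.1.2.factorial : ℂ)) =
      (‖fockComp i.1.1 i.1.2 h k‖ : ℂ) ^ 2 := fun i => by
    rw [← inner_fockComp]
    exact symL2_inner_self _
  simp_rw [h2] at h1
  simpa using h1.norm

/-- The exponential vector in the sum of the spaces of symmetric functions. -/
def fockVec (i : Σ n : ℕ, ((Fin n → Bool) → ℂ) × ((Fin n → Bool) → ℂ)) :
    Fock :=
  ⟨_, memℓp_fockComp i.2.1 i.2.2⟩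

lemma fockVec_apply (i : Σ n : ℕ, ((Fin n → Bool) → ℂ) × ((Fin n → Bool) → ℂ))
    (r : {i : ℕ × ℕ // 0 < i.1 + i.2}) : fockVec i r = fockComp r.1.1 r.1.2 i.2.1 i.2.2 := rfl

lemma fockVec_raise {n N : ℕ} (hn : n ≤ N) (h k : (Fin n → Bool) → ℂ) :
    fockVec ⟨N, raise hn h, raise hn k⟩ = fockVec ⟨n, h, k⟩ := rfl

lemma inner_fockVec {n : ℕ} (h k h' k' : (Fin n → Bool) → ℂ) :
    ⟪fockVec ⟨n, h, k⟩, fockVec ⟨n, h', k'⟩⟫_ℂ =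
      Complex.exp (⟪stepL2 h, stepL2 h'⟫_ℂ + ⟪stepL2 k', stepL2 k⟫_ℂ) - 1 := by
  rw [lp.inner_eq_tsum]
  simp only [fockVec_apply, inner_fockComp]
  exact (hasSum_exp_two _ _).tsum_eq

lemma fockComp_smul (p q : ℕ) {n : ℕ} (h k : (Fin n → Bool) → ℂ) (z w : ℂ) :
    fockComp p q (w • h) (z • k) = (starRingEnd ℂ z ^ p * w ^ q) • fockComp p q h k := by
  rw [fockComp, fockComp, smul_comm]
  congr 1
  refine Subtype.ext (Lp.ext ?_)
  refine (coeFn_tensL2 _ _).trans ?_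
  filter_upwards [Lp.coeFn_smul (starRingEnd ℂ z ^ p * w ^ q)
    (tensL2 (fun _ : Fin p => star k) (fun _ : Fin q => h)),
    coeFn_tensL2 (fun _ : Fin p => star k) (fun _ : Fin q => h)] with x h1 h2
  refine Eq.trans ?_ h1.symm
  rw [Pi.smul_apply, h2]
  simp [tensFun, stepFun, Finset.prod_mul_distrib]
  ring

/-- Scaling the two arguments by complex parameters makes the inner product with `v` a power series
in two variables whose coefficients are the inner products of the components. All of these vanish,
and polarization passes from diagonal tensors to arbitrary ones. -/
lemma fockVec_total (v : Fock)
    (h : ∀ i, ⟪fockVec i, v⟫_ℂ = 0) : v = 0 := by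
  have key : ∀ (n : ℕ) (c d : (Fin n → Bool) → ℂ) (r : {i : ℕ × ℕ // 0 < i.1 + i.2}),
      ⟪fockComp r.1.1 r.1.2 c d, v r⟫_ℂ = 0 := by
    intro n c d r
    let a : ℕ × ℕ → ℂ := fun i => if hi : 0 < i.1 + i.2 then
      ⟪fockComp i.1 i.2 c d, v ⟨i, hi⟩⟫_ℂ else 0
    have ha : a r.1 = 0 := by
      refine coeff_eq_zero_of_hasSum_two (fun z w => ?_) r.1
      -- The parameter `w` is conjugated because the first argument of the inner product is
      -- conjugate-linear; `z` is not, since the second argument enters `fockComp` conjugated.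
      have h1 := lp.hasSum_inner (𝕜 := ℂ) (fockVec ⟨n, starRingEnd ℂ w • c, z • d⟩) v
      rw [h] at h1
      have h2 : HasSum ((fun i : ℕ × ℕ => a i * z ^ i.1 * w ^ i.2) ∘
          ((↑) : {i : ℕ × ℕ // 0 < i.1 + i.2} → ℕ × ℕ)) 0 := by
        refine h1.congr_fun fun i => ?_
        rw [fockVec_apply, fockComp_smul, symL2_inner_smul_left]
        simp only [Function.comp_apply, a, dif_pos i.2]
        simp
        ring
      refine (hasSum_subtype_iff_of_support_subset (s := {i : ℕ × ℕ | 0 < i.1 + i.2}) ?_).1 h2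
      intro i hi
      by_contra hi'
      exact hi (by simp only [a, dif_neg (show ¬ 0 < i.1 + i.2 from hi'), zero_mul])
    simpa only [a, dif_pos r.2] using ha
  refine lp.ext (funext fun r => Subtype.ext ?_)
  refine eq_zero_of_inner_tensL2 fun n x y => inner_tensL2_eq_zero (v r).2 (fun n c d => ?_) x y
  obtain ⟨c', rfl⟩ : ∃ c', c = star c' := ⟨star c, (star_star c).symm⟩
  have h1 := key n d c' r
  rw [fockComp, symL2_inner_smul_left, mul_eq_zero] at h1
  have h2 := h1.resolve_left (by
    rw [Complex.conj_ofReal, Complex.ofReal_eq_zero]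
    exact ne_of_gt (by positivity))
  exact h2

/-! ### The multiplication representation on exponential vectors -/

lemma coeFn_rMap (p q : ℕ) (g : L0) : rMap p q g =ᵐ[muPQ p q] rFun p q g := AEEqFun.coeFn_mk _ _

/-- Here `k` enters conjugated, so `c⁻¹ k` contributes `c` in each of the first `p` variables, while
`c⁻¹ h` contributes `c⁻¹` in each of the last `q`: exactly the multiplier of `rho`. -/
lemma rho_step_fockComp (p q : ℕ) {n : ℕ} (c : (Fin n → Bool) → Circle)
    (h k : (Fin n → Bool) → ℂ) : rho p q (step c) (fockComp p q h k) =
      fockComp p q (fun t => ((c⁻¹ t : Circle) : ℂ) * h t) fun t => ((c⁻¹ t : Circle) : ℂ) * k t := by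
  rw [fockComp, fockComp, map_smul]
  congr 1
  refine Subtype.ext ?_
  change circleMul (rMap p q (step c)) (tensL2 _ _) = tensL2 _ _
  refine Lp.ext ?_
  filter_upwards [coeFn_circleMul (rMap p q (step c))
      (tensL2 (fun _ : Fin p => star k) (fun _ : Fin q => h)),
    coeFn_tensL2 (fun _ : Fin p => star k) (fun _ : Fin q => h), coeFn_rMap p q (step c),
    rFun_congr p q (coeFn_step c),
    coeFn_tensL2 (fun _ : Fin p => star fun t => ((c⁻¹ t : Circle) : ℂ) * k t)
      (fun _ : Fin q => fun t => ((c⁻¹ t : Circle) : ℂ) * h t)] with z h1 h2 h3 h4 h5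
  rw [h1, h2, h3, h4, h5]
  have hconj : ∀ a : Circle, starRingEnd ℂ (a : ℂ) = (a : ℂ)⁻¹ := fun a => by
    rw [← Circle.coe_inv, ← Circle.coe_inv_eq_conj]
  have hprod : ∀ {m : ℕ} (w : Fin m → Circle), ((∏ i, w i : Circle) : ℂ) = ∏ i, (w i : ℂ) :=
    fun w => map_prod Circle.coeHom w _
  simp [rFun, tensFun, stepFun, Finset.prod_mul_distrib, hconj, hprod]
  ring

lemma tendsto_rho (p q : ℕ) {u : ℕ → L0} {g : L0}
    (h : ∀ᵐ a ∂lam, Tendsto (fun n => u n a) atTop (𝓝 (g a))) (x : symL2 p q) :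
    Tendsto (fun n => rho p q (u n) x) atTop (𝓝 (rho p q g x)) := by
  refine tendsto_subtype_rng.2 ?_
  refine tendsto_circleMul ?_ x.1
  have h1 : ∀ᵐ z ∂muPQ p q, ∀ i, Tendsto (fun n => u n (z.1 i)) atTop (𝓝 (g (z.1 i))) :=
    ae_all_iff.2 fun i => (mp_fst p q i).quasiMeasurePreserving.ae h
  have h2 : ∀ᵐ z ∂muPQ p q, ∀ i, Tendsto (fun n => u n (z.2 i)) atTop (𝓝 (g (z.2 i))) :=
    ae_all_iff.2 fun i => (mp_snd p q i).quasiMeasurePreserving.ae h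
  filter_upwards [h1, h2, coeFn_rMap p q g, ae_all_iff.2 fun n => coeFn_rMap p q (u n)]
    with z h3 h4 h5 h6
  rw [h5]
  simp_rw [h6]
  exact (tendsto_finsetProd _ fun i _ => h3 i).mul (tendsto_finsetProd _ fun j _ => (h4 j).inv)

/-! ### The isomorphism -/

lemma exists_expVec_equiv : ∃ Φ : ((constants gamInf)ᗮ : Submodule ℂ (Lp ℂ 2 gamInf)) ≃ₗᵢ[ℂ]
    Fock,
    ∀ i, Φ (expVec i) = fockVec i := by
  refine exists_linearIsometryEquiv_of_inner_eq (fun i j => ?_)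
    (span_closure_eq_top expVec_total) (span_closure_eq_top fockVec_total)
  obtain ⟨n, h, k⟩ := i
  obtain ⟨m, h', k'⟩ := j
  rw [← expVec_raise (le_max_left n m) h k, ← expVec_raise (le_max_right n m) h' k',
    ← fockVec_raise (le_max_left n m) h k, ← fockVec_raise (le_max_right n m) h' k',
    inner_fockVec]
  exact inner_expSub _ _ _ _

/-- The `ℓ²`-sum of the representations `rho p q` over the pairs of positive total degree. -/
def rhoSum : UnitaryRep L0 Fock :=
  UnitaryRep.ellTwoSum fun i : {i : ℕ × ℕ // 0 < i.1 + i.2} => rho i.1.1 i.1.2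

lemma rhoSum_apply (g : L0) (v : Fock) (r : {i : ℕ × ℕ // 0 < i.1 + i.2}) :
    rhoSum g v r = rho r.1.1 r.1.2 g (v r) := rfl

lemma rhoSum_step_fockVec {n : ℕ} (c : (Fin n → Bool) → Circle) (h k : (Fin n → Bool) → ℂ) :
    rhoSum (step c) (fockVec ⟨n, h, k⟩) =
      fockVec ⟨n, fun t => ((c⁻¹ t : Circle) : ℂ) * h t, fun t => ((c⁻¹ t : Circle) : ℂ) * k t⟩ :=
  lp.ext (funext fun r => rho_step_fockComp r.1.1 r.1.2 c h k)

/-- After raising `c`, `h` and `k` to a common level, both representations change the index of the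
vector in the same way. -/
lemma exists_step_expVec {n : ℕ} (c : (Fin n → Bool) → Circle)
    (i : Σ n : ℕ, ((Fin n → Bool) → ℂ) × ((Fin n → Bool) → ℂ)) :
    ∃ j, koopmanZero gaussAction (step c) (expVec i) = expVec j ∧
      rhoSum (step c) (fockVec i) = fockVec j := by
  obtain ⟨m, h, k⟩ := i
  have h1 := koopmanZero_step_expVec (raise (le_max_left n m) c) (raise (le_max_right n m) h)
    (raise (le_max_right n m) k)
  have h2 := rhoSum_step_fockVec (raise (le_max_left n m) c) (raise (le_max_right n m) h)
    (raise (le_max_right n m) k)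
  rw [expVec_raise, step_raise] at h1
  rw [fockVec_raise, step_raise] at h2
  exact ⟨_, h1, h2⟩

lemma tendsto_Fock_apply {u : ℕ → Fock} {v : Fock} (h : Tendsto u atTop (𝓝 v))
    (r : {i : ℕ × ℕ // 0 < i.1 + i.2}) : Tendsto (fun j => u j r) atTop (𝓝 (v r)) := by
  rw [tendsto_iff_norm_sub_tendsto_zero] at h ⊢
  exact squeeze_zero (fun _ => norm_nonneg _)
    (fun j => lp.norm_apply_le_norm two_ne_zero (u j - v) r) h

lemma expVec_equiv_step {Φ : ((constants gamInf)ᗮ : Submodule ℂ (Lp ℂ 2 gamInf)) ≃ₗᵢ[ℂ] Fock}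
    (hΦ : ∀ i, Φ (expVec i) = fockVec i) {n : ℕ} (c : (Fin n → Bool) → Circle)
    (x : ((constants gamInf)ᗮ : Submodule ℂ (Lp ℂ 2 gamInf))) :
    Φ (koopmanZero gaussAction (step c) x) = rhoSum (step c) (Φ x) := by
  have key : ∀ i, Φ (koopmanZero gaussAction (step c) (expVec i)) =
      rhoSum (step c) (Φ (expVec i)) := fun i => by
    obtain ⟨j, h1, h2⟩ := exists_step_expVec c i
    exact (congrArg Φ h1).trans ((hΦ j).trans (h2.symm.trans (congrArg _ (hΦ i).symm)))
  exact intertwines_of_total (A := koopmanZero gaussAction (step c)) (B := rhoSum (step c))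
    (span_closure_eq_top expVec_total) key x

lemma expVec_equiv_intertwines
    {Φ : ((constants gamInf)ᗮ : Submodule ℂ (Lp ℂ 2 gamInf)) ≃ₗᵢ[ℂ] Fock}
    (hΦ : ∀ i, Φ (expVec i) = fockVec i) (g : L0)
    (x : ((constants gamInf)ᗮ : Submodule ℂ (Lp ℂ 2 gamInf))) :
    Φ (koopmanZero gaussAction g x) = rhoSum g (Φ x) := by
  obtain ⟨n, c, hc⟩ := exists_seq_step_tendsto g
  -- Working in each degree separately, only the continuity of the single representations `rho p q`
  -- is needed, not that of their infinite sum.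
  refine lp.ext (funext fun r => ?_)
  have h1 : Tendsto (fun j => Φ (koopmanZero gaussAction (step (c j)) x)) atTop
      (𝓝 (Φ (koopmanZero gaussAction g x))) :=
    (Φ.continuous.tendsto _).comp (tendsto_koopmanZero hc x)
  refine tendsto_nhds_unique (tendsto_Fock_apply h1 r) ?_
  refine (tendsto_rho _ _ hc (Φ x r)).congr fun j => ?_
  rw [expVec_equiv_step hΦ, rhoSum_apply]

theorem koopmanZero_gaussAction_isomorphic :
    UnitaryRep.Isomorphic (koopmanZero gaussAction) rhoSum := by
  obtain ⟨Φ, hΦ⟩ := exists_expVec_equiv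
  exact ⟨Φ, expVec_equiv_intertwines hΦ⟩

end KoopmanL0

end

end

theorem theorem2p3 :
    (∃! Θ : KoopmanL0.L0 →* KoopmanL0.Aut KoopmanL0.gamInf, KoopmanL0.IsGaussianAction Θ) ∧
    ∀ Θ : KoopmanL0.L0 →* KoopmanL0.Aut KoopmanL0.gamInf, KoopmanL0.IsGaussianAction Θ →
      KoopmanL0.UnitaryRep.Isomorphic
        (KoopmanL0.koopmanZero Θ)
        (KoopmanL0.UnitaryRep.ellTwoSum
          fun i : {i : ℕ × ℕ // 0 < i.1 + i.2} => KoopmanL0.rho i.1.1 i.1.2) := by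
  refine ⟨⟨KoopmanL0.gaussAction, KoopmanL0.isGaussianAction_gaussAction, fun Θ h =>
    h.unique KoopmanL0.isGaussianAction_gaussAction⟩, fun Θ h => ?_⟩
  -- Uniqueness reduces the spectral statement to the action constructed explicitly.
  rw [h.unique KoopmanL0.isGaussianAction_gaussAction]
  exact KoopmanL0.koopmanZero_gaussAction_isomorphic
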